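/- Let $\mathbb{F}\in\{\mathbb{R},\mathbb{C},\mathbb{H}\}$ and let $U(4,\mathbb{F})$ be $\mathrm{SO}(4)$, $\mathrm{U}(4)$, $\mathrm{Sp}(4)$ respectively. Let $E(4,\mathbb{F})=\{A\in M(4,\mathbb{F}): A^*=A,\ \operatorname{tr}A=0\}$ with the Euclidean inner product $\langle A,B\rangle=\operatorname{Re}\operatorname{tr}(AB^*)$, let $S(4,\mathbb{F})$ be its unit sphere, and let $U(4,\mathbb{F})$ act on $E(4,\mathbb{F})$ by $P\cdot A=P^*AP$. Let $\mathcal{C}_{4,\mathbb{F}}$ be the set of critical points of the function $f_3:S(4,\mathbb{F})\to\mathbb{R}$, $f_3(A)=\operatorname{tr}A^3$, at which $f_3=0$. Then: (1) $\mathcal{C}_{4,\mathbb{F}}$ is the orbit $U(4,\mathbb{F})\cdot\frac12\operatorname{diag}(1,-1,1,-1)$, and it is compact. (2) $\mathcal{C}_{4,\mathbb{F}}$ is an austere submanifold of $S(4,\mathbb{F})$: it is a smooth embedded submanifold, and for every $A\in\mathcal{C}_{4,\mathbb{F}}$ and every normal vector $\xi$ of $\mathcal{C}_{4,\mathbb{F}}$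 in $S(4,\mathbb{F})$ at $A$, the multiset of principal curvatures (eigenvalues of the shape operator $S_\xi$, with multiplicity) is invariant under $\lambda\mapsto-\lambda$, i.e. of the form $\{\lambda_1,-\lambda_1,\dots,\lambda_p,-\lambda_p,0,\dots,0\}$. (3) $\mathcal{C}_{4,\mathbb{F}}$ is diffeomorphic (in particular homeomorphic) to the Grassmann manifold $\mathrm{G}_2(\mathbb{F}^4)$ of $2$-dimensional $\mathbb{F}$-subspaces of $\mathbb{F}^4$. -/

import Mathlib

open scoped ContDiff Quaternion Topology

attribute [local instance] Matrix.frobeniusSeminormedAddCommGroup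
  Matrix.frobeniusNormedAddCommGroup Matrix.frobeniusNormedSpace

noncomputable section

/-! ### Austere submanifolds of the unit sphere of a Euclidean space -/

section Submanifolds

variable {E : Type*} [NormedAddCommGroup E] [InnerProductSpace ℝ E]

/-- `φ`, restricted to the open set `U` of `ℝᵏ`, is a smooth local parametrization of the
subset `M` of `E`: a smooth immersion that is a homeomorphism from `U` onto a relatively open
subset of `M`. -/
structure IsLocalParametrization (M : Set E) {k : ℕ} (U : Set (EuclideanSpace ℝ (Fin k)))
    (φ : EuclideanSpace ℝ (Fin k) → E) : Prop where
  isOpen : IsOpen U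
  contDiffOn : ContDiffOn ℝ ∞ φ U
  immersive : ∀ x ∈ U, Function.Injective (fderiv ℝ φ x)
  isEmbedding : Topology.IsEmbedding (U.domRestrict φ)
  image_eq : ∃ W : Set E, IsOpen W ∧ φ '' U = M ∩ W

/-- `M` is a smooth embedded submanifold of dimension `k` of the Euclidean space `E`. -/
def IsEmbeddedSubmanifold (k : ℕ) (M : Set E) : Prop :=
  ∀ p ∈ M, ∃ (U : Set (EuclideanSpace ℝ (Fin k))) (φ : EuclideanSpace ℝ (Fin k) → E),
    IsLocalParametrization M U φ ∧ p ∈ φ '' U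

/-- The tangent space, at the point `φ x`, of the submanifold parametrized by `φ`. -/
def tangentSpaceOf {k : ℕ} (φ : EuclideanSpace ℝ (Fin k) → E) (x : EuclideanSpace ℝ (Fin k)) :
    Submodule ℝ E :=
  LinearMap.range (fderiv ℝ φ x : EuclideanSpace ℝ (Fin k) →ₗ[ℝ] E)

/-- The normal space at `φ x` of the submanifold parametrized by `φ`, as a submanifold of the
unit sphere: the vectors tangent to the sphere (orthogonal to `φ x`) and orthogonal to the
submanifold. -/
def sphereNormalSpace {k : ℕ} (φ : EuclideanSpace ℝ (Fin k) → E)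
    (x : EuclideanSpace ℝ (Fin k)) : Submodule ℝ E :=
  (tangentSpaceOf φ x ⊔ Submodule.span ℝ {φ x})ᗮ

/-- The scalar second fundamental form in direction `ξ`, in the coordinates given by `φ`:
`h i j = ⟪∇_{∂i} ∂j φ, ξ⟫`, where `∇` is the Levi-Civita connection of the sphere.
The latter is the tangential part of the derivative in `E`, and `ξ` is tangent to the sphere,
so the derivative in `E` can be used. -/
def secondFormMatrix {k : ℕ} (φ : EuclideanSpace ℝ (Fin k) → E)
    (x : EuclideanSpace ℝ (Fin k)) (ξ : E) : Matrix (Fin k) (Fin k) ℝ :=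
  Matrix.of fun i j => inner ℝ
    (fderiv ℝ (fderiv ℝ φ) x (EuclideanSpace.single i 1) (EuclideanSpace.single j 1)) ξ

/-- The first fundamental form (Gram matrix of the coordinate vector fields). -/
def firstFormMatrix {k : ℕ} (φ : EuclideanSpace ℝ (Fin k) → E)
    (x : EuclideanSpace ℝ (Fin k)) : Matrix (Fin k) (Fin k) ℝ :=
  Matrix.of fun i j => inner ℝ
    (fderiv ℝ φ x (EuclideanSpace.single i 1)) (fderiv ℝ φ x (EuclideanSpace.single j 1))

/-- The matrix `g⁻¹ h` of the shape operator `S_ξ`, determined by `⟪S_ξ X, Y⟫ = ⟪II(X, Y), ξ⟫`,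
in the basis `∂₁φ, …, ∂ₖφ` of the tangent space. -/
def shapeOperatorMatrix {k : ℕ} (φ : EuclideanSpace ℝ (Fin k) → E)
    (x : EuclideanSpace ℝ (Fin k)) (ξ : E) : Matrix (Fin k) (Fin k) ℝ :=
  (firstFormMatrix φ x)⁻¹ * secondFormMatrix φ x ξ

/-- The principal curvatures in direction `ξ`, listed with multiplicity. -/
def principalCurvatures {k : ℕ} (φ : EuclideanSpace ℝ (Fin k) → E)
    (x : EuclideanSpace ℝ (Fin k)) (ξ : E) : Multiset ℝ :=
  (shapeOperatorMatrix φ x ξ).charpoly.roots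

/-- `M` is an austere submanifold of the unit sphere of `E`: an embedded submanifold, contained
in the sphere, such that for every normal vector the multiset of principal curvatures is
invariant under `λ ↦ -λ`, that is, has the form `{λ₁, -λ₁, …, λₚ, -λₚ, 0, …, 0}`. -/
def IsAustereSubmanifoldOfSphere (M : Set E) : Prop :=
  M ⊆ Metric.sphere (0 : E) 1 ∧
  ∃ k : ℕ, IsEmbeddedSubmanifold k M ∧
    ∀ (U : Set (EuclideanSpace ℝ (Fin k))) (φ : EuclideanSpace ℝ (Fin k) → E),
      IsLocalParametrization M U φ →
      ∀ x ∈ U, ∀ ξ ∈ sphereNormalSpace φ x,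
        (principalCurvatures φ x ξ).map (fun c => -c) = principalCurvatures φ x ξ

end Submanifolds

/-! ### Grassmannians -/

section Grassmannians

variable (k n : ℕ) (F : Type*) [NormedDivisionRing F] [InnerProductSpace ℝ F]

/-- The space of `k`-frames (linearly independent `k`-tuples) in `Fⁿ`. -/
def frames : Set (Fin k → Fin n → F) := {b | LinearIndependent F b}

/-- The Grassmannian of `k`-dimensional `F`-subspaces of `Fⁿ`. -/
def Gr : Type _ := {V : Submodule F (Fin n → F) // Module.finrank F V = k}

variable {k n F}

/-- The subspace spanned by a frame. -/
def frameSpan (b : frames k n F) : Gr k n F :=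
  ⟨Submodule.span F (Set.range b.1), by
    have h := finrank_span_eq_card b.2
    simpa using h⟩

/-- The Grassmannian carries the quotient topology of the space of frames. -/
instance : TopologicalSpace (Gr k n F) :=
  TopologicalSpace.coinduced (frameSpan (k := k) (n := n) (F := F)) inferInstance

/-- The homeomorphism `e` from the Grassmannian onto the submanifold `M` of `E` is a
diffeomorphism. The smooth structure of the Grassmannian is the one for which `frameSpan`, from
the open set of frames, is a surjective submersion; so a map out of the Grassmannian is smooth iff
it is smooth as a function of the frame, and a map into it is smooth iff it lifts locally to a
smooth frame. -/
structure IsGrassmannDiffeo {E : Type*} [NormedAddCommGroup E] [NormedSpace ℝ E] {M : Set E}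
    (e : Gr k n F ≃ₜ M) : Prop where
  smooth_toFun : ∃ f : (Fin k → Fin n → F) → E, ContDiffOn ℝ ∞ f (frames k n F) ∧
    ∀ b : frames k n F, f b = e (frameSpan b)
  smooth_invFun : ∀ p : M, ∃ s : E → (Fin k → Fin n → F), ContDiffAt ℝ ∞ s p ∧
    ∀ᶠ q in 𝓝 (p : E), ∀ hq : q ∈ M,
      ∃ hs : s q ∈ frames k n F, frameSpan ⟨s q, hs⟩ = e.symm ⟨q, hq⟩

end Grassmannians

/-! ### Traceless Hermitian matrices over `ℝ`, `ℂ`, `ℍ` -/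

section Hermitian

variable (n : ℕ) (F : Type*) [NormedDivisionRing F] [InnerProductSpace ℝ F]

/-- The Euclidean inner product `∑ ⟪A i j, B i j⟫` on matrices, which induces the Frobenius norm.
For `F = ℝ, ℂ, ℍ` one has `⟪a, b⟫ = Re (a * star b)`, so this is `Re (tr (A * Bᴴ))`. -/
instance matrixInnerProductSpace {n : ℕ} {F : Type*} [NormedDivisionRing F]
    [InnerProductSpace ℝ F] : InnerProductSpace ℝ (Matrix (Fin n) (Fin n) F) where
  inner A B := ∑ i, ∑ j, inner ℝ (A i j) (B i j)
  norm_sq_eq_re_inner A := by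
    rw [Matrix.frobenius_norm_def, ← Real.sqrt_eq_rpow, Real.sq_sqrt (by positivity)]
    simp
  conj_inner_symm A B := by simp [real_inner_comm]
  add_left A B C := by simp [inner_add_left, Finset.sum_add_distrib]
  smul_left A B r := by simp [inner_smul_left, Finset.mul_sum]

variable [StarRing F] [StarModule ℝ F]

/-- `E(n, F)`: the real vector space of traceless Hermitian `n × n` matrices over `F`. -/
def tracelessHermitian : Submodule ℝ (Matrix (Fin n) (Fin n) F) where
  carrier := {A | A.IsHermitian ∧ A.trace = 0}
  add_mem' hA hB := ⟨hA.1.add hB.1, by rw [Matrix.trace_add, hA.2, hB.2, add_zero]⟩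
  zero_mem' := ⟨Matrix.isHermitian_zero, Matrix.trace_zero _ _⟩
  smul_mem' r A hA := ⟨by
    have h : A.conjTranspose = A := hA.1
    rw [Matrix.IsHermitian, Matrix.conjTranspose_smul, h, star_trivial],
    by rw [Matrix.trace_smul, hA.2, smul_zero]⟩

variable {n F}

/-- `F_k(A) = tr (A ^ k)`, a real number; the real part of `a : F` is `⟪1, a⟫`. -/
def powerTrace (k : ℕ) (A : tracelessHermitian n F) : ℝ :=
  inner ℝ (1 : F) ((A : Matrix (Fin n) (Fin n) F) ^ k).trace

variable (n F)

/-- `Φ = (F₃, F₅, …, F_{2p+1})` with `p = ⌊(n - 1) / 2⌋`. -/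
def oddPowerTraces (A : tracelessHermitian n F) : Fin ((n - 1) / 2) → ℝ :=
  fun i => powerTrace (2 * (i : ℕ) + 3) A

/-- `C_{n, F}`: the critical points, on the unit sphere `S(n, F)` of `E(n, F)`, of the restriction
of `Φ` to this sphere, that lie in its zero set. The tangent space of the sphere at `A` is
`Aᗮ`. -/
def criticalZeroSet : Set (tracelessHermitian n F) :=
  {A | A ∈ Metric.sphere (0 : tracelessHermitian n F) 1 ∧ oddPowerTraces n F A = 0 ∧
    ¬ Function.Surjective fun X : (Submodule.span ℝ {A})ᗮ =>
      fderiv ℝ (oddPowerTraces n F) A (X : tracelessHermitian n F)}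

variable {n F}

/-- The orbit of the matrix `D` under the action `P · D = Pᴴ D P` of the matrix group `G`. -/
def conjugationOrbit (G : Submonoid (Matrix (Fin n) (Fin n) F)) (D : Matrix (Fin n) (Fin n) F) :
    Set (tracelessHermitian n F) :=
  {A | ∃ P ∈ G, (A : Matrix (Fin n) (Fin n) F) = P.conjTranspose * D * P}

end Hermitian

instance : StarModule ℝ ℍ[ℝ] := ⟨fun r a => by simp [Quaternion.star_smul]⟩

/-- The matrix `½ diag(1, -1, 1, -1)`. -/
def halfDiag (F : Type*) [NormedDivisionRing F] [InnerProductSpace ℝ F] :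
    Matrix (Fin 4) (Fin 4) F :=
  (1 / 2 : ℝ) • Matrix.diagonal ![1, -1, 1, -1]

end

/-! Everything rests on the identity `A * A = ¼`. If `A` is a critical point in the zero set, then
`Y = A² - ¼` is traceless because `tr A² = 1`, and orthogonal to `A` because `tr A³ = 0`.
Criticality gives `tr (A² Y) = 0`, hence `⟪Y, Y⟫ = 0`. The converse is immediate
(`mem_criticalZeroSet_iff`). So the critical set consists of the matrices `P - ½` with `P` a
Hermitian projection of rank two. Orthonormal frames `B`, `C` of the two eigenspaces (`IsSplitting`)
diagonalize `A`, which gives the orbit. Sending `A` to the row space of `P` gives the Grassmannian.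
The graphs `B + Y * C`, with `Y` an arbitrary `2 × 2` matrix, give the charts.

Austerity comes from a symmetry. Differentiating `A² = ¼` once shows that tangent vectors
anticommute with `A`, and a dimension count shows that these are all of them. Differentiating twice
expresses the second fundamental form as `-2 Re tr ((XY + YX) A ξ)`. A normal vector `ξ` commutes
with `A` and is orthogonal to `1` and `A`, so it consists of two traceless Hermitian `2 × 2` blocks.
Each block anticommutes with a unitary matrix, and together these form a unitary `Q` commuting with
`A` and anticommuting with `ξ` (`IsSplitting.exists_unitary`). Conjugation by `Q` is an isometry
that preserves the tangent space and reverses the second fundamental form, so the shape operator is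
similar to its negative (`principalCurvatures_map_neg`).

The three fields are treated at once. Over `ℍ` the trace is not cyclic and determinants are
unavailable, so the real part of the trace and `det₂` replace them. -/

section

open scoped Matrix

set_option linter.unusedSectionVars false

-- Matrices carry the topology of the Frobenius norm; the competing product topology instance is
-- switched off.
attribute [-instance] instTopologicalSpaceMatrix

/-! ### Real division algebras with a compatible star -/

/-- The properties of `ℝ`, `ℂ` and `ℍ`, with conjugation and Euclidean inner product, that the
arguments below use. -/
class IsEuclideanStar (F : Type*) [NormedDivisionRing F] [InnerProductSpace ℝ F] [StarRing F] :
    Prop where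
  inner_eq : ∀ a b : F, inner ℝ a b = inner ℝ 1 (a * star b)
  mul_star : ∀ a : F, a * star a = (‖a‖ ^ 2) • (1 : F)
  star_mul : ∀ a : F, star a * a = (‖a‖ ^ 2) • (1 : F)
  eq_of_star : ∀ a : F, star a = a → a = (inner ℝ 1 a : ℝ) • (1 : F)

instance : IsEuclideanStar ℝ where
  inner_eq a b := by simp [mul_comm]
  mul_star a := by simp [sq]
  star_mul a := by simp [sq]
  eq_of_star a h := by simp

instance : IsEuclideanStar ℂ where
  inner_eq a b := by simp [Complex.inner]; ring
  mul_star a := by simp [Complex.mul_conj, Complex.normSq_eq_norm_sq]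
  star_mul a := by simp [← Complex.normSq_eq_conj_mul_self, Complex.normSq_eq_norm_sq]
  eq_of_star a h := by
    obtain ⟨r, rfl⟩ := Complex.conj_eq_iff_real.1 h
    simp [Complex.inner]

instance : IsEuclideanStar ℍ[ℝ] where
  inner_eq a b := by simp [Quaternion.inner_def]; ring
  mul_star a := by
    rw [Quaternion.self_mul_star, Quaternion.normSq_eq_norm_mul_self, ← sq,
      ← Algebra.algebraMap_eq_smul_one]
    rfl
  star_mul a := by
    rw [Quaternion.star_mul_self, Quaternion.normSq_eq_norm_mul_self, ← sq,
      ← Algebra.algebraMap_eq_smul_one]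
    rfl
  eq_of_star a h := by
    have h' := Quaternion.star_eq_self.1 h
    rw [← Algebra.algebraMap_eq_smul_one, Quaternion.inner_def]
    simpa using h'

section Scalars

variable {F : Type*} [NormedDivisionRing F] [InnerProductSpace ℝ F] [StarRing F]
  [IsEuclideanStar F]

lemma norm_star_eq (a : F) : ‖star a‖ = ‖a‖ := by
  have h := IsEuclideanStar.mul_star (star a)
  rw [star_star, IsEuclideanStar.star_mul] at h
  have h' := smul_left_injective ℝ (one_ne_zero (α := F)) h
  exact ((sq_eq_sq₀ (norm_nonneg _) (norm_nonneg _)).1 h').symm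

lemma inner_star_star (a b : F) : inner ℝ (star a) (star b) = inner ℝ a b := by
  rw [real_inner_eq_norm_add_mul_self_sub_norm_mul_self_sub_norm_mul_self_div_two,
    real_inner_eq_norm_add_mul_self_sub_norm_mul_self_sub_norm_mul_self_div_two, ← star_add,
    norm_star_eq, norm_star_eq, norm_star_eq]

lemma inner_one_star (a : F) : inner ℝ (1 : F) (star a) = inner ℝ 1 a := by
  rw [← inner_star_star 1 a, star_one]

/-- Both sides are inner products, matched by the invariance of the inner product under `star`. This
is the substitute for commutativity that makes `reTr` cyclic. -/
lemma inner_one_mul_comm (a b : F) : inner ℝ (1 : F) (a * b) = inner ℝ 1 (b * a) := by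
  have h₁ := IsEuclideanStar.inner_eq a (star b)
  have h₂ := IsEuclideanStar.inner_eq b (star a)
  rw [star_star] at h₁ h₂
  rw [← h₁, ← h₂, ← inner_star_star, star_star, real_inner_comm]

end Scalars

/-! ### The real part of the trace -/

section Trace

variable {F : Type*} [NormedDivisionRing F] [InnerProductSpace ℝ F]
variable {m n : Type*} [Fintype m] [Fintype n]

/-- The real part of the trace. -/
def reTr (M : Matrix n n F) : ℝ := inner ℝ (1 : F) M.trace

lemma reTr_add (M N : Matrix n n F) : reTr (M + N) = reTr M + reTr N := by
  simp [reTr, Matrix.trace_add, inner_add_right]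

lemma reTr_sub (M N : Matrix n n F) : reTr (M - N) = reTr M - reTr N := by
  simp [reTr, Matrix.trace_sub, inner_sub_right]

lemma reTr_neg (M : Matrix n n F) : reTr (-M) = -reTr M := by
  simp [reTr, Matrix.trace_neg]

lemma reTr_smul (c : ℝ) (M : Matrix n n F) : reTr (c • M) = c * reTr M := by
  simp [reTr, Matrix.trace_smul, inner_smul_right]

@[simp] lemma reTr_zero : reTr (0 : Matrix n n F) = 0 := by simp [reTr]

lemma reTr_one [DecidableEq n] : reTr (1 : Matrix n n F) = Fintype.card n := by
  have : ((Fintype.card n : ℕ) : F) = (Fintype.card n : ℝ) • (1 : F) := by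
    rw [Nat.cast_smul_eq_nsmul, nsmul_one]
  rw [reTr, Matrix.trace_one, this, inner_smul_right]
  simp

variable [StarRing F] [IsEuclideanStar F]

lemma reTr_mul_comm (M : Matrix m n F) (N : Matrix n m F) : reTr (M * N) = reTr (N * M) := by
  simp only [reTr, Matrix.trace, Matrix.diag_apply, Matrix.mul_apply, inner_sum]
  rw [Finset.sum_comm]
  simp only [inner_one_mul_comm]

lemma reTr_mul_conjTranspose (M N : Matrix m n F) :
    reTr (M * Nᴴ) = ∑ i, ∑ j, inner ℝ (M i j) (N i j) := by
  simp only [reTr, Matrix.trace, Matrix.diag_apply, Matrix.mul_apply, inner_sum,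
    Matrix.conjTranspose_apply, ← IsEuclideanStar.inner_eq]

lemma matrix_inner_eq {n : ℕ} (M N : Matrix (Fin n) (Fin n) F) :
    inner ℝ M N = reTr (M * Nᴴ) := (reTr_mul_conjTranspose M N).symm

lemma reTr_mul_conjTranspose_self_nonneg (M : Matrix m n F) : 0 ≤ reTr (M * Mᴴ) := by
  rw [reTr_mul_conjTranspose]
  exact Finset.sum_nonneg fun i _ => Finset.sum_nonneg fun j _ => real_inner_self_nonneg

lemma eq_zero_of_reTr_mul_conjTranspose (M : Matrix m n F) (h : reTr (M * Mᴴ) = 0) : M = 0 := by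
  rw [reTr_mul_conjTranspose] at h
  ext i j
  have h₁ := (Finset.sum_eq_zero_iff_of_nonneg fun i _ =>
    Finset.sum_nonneg fun j _ => real_inner_self_nonneg).1 h i (Finset.mem_univ _)
  have h₂ := (Finset.sum_eq_zero_iff_of_nonneg fun j _ => real_inner_self_nonneg).1 h₁ j
    (Finset.mem_univ _)
  simpa using h₂

lemma eq_zero_of_mul_conjTranspose (M : Matrix m n F) (h : M * Mᴴ = 0) : M = 0 :=
  eq_zero_of_reTr_mul_conjTranspose M (by rw [h, reTr_zero])

lemma trace_eq_of_isHermitian {M : Matrix n n F} (h : M.IsHermitian) :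
    M.trace = reTr M • (1 : F) := by
  refine IsEuclideanStar.eq_of_star _ ?_
  rw [← Matrix.trace_conjTranspose, h.eq]

lemma trace_eq_zero_iff {M : Matrix n n F} (h : M.IsHermitian) : M.trace = 0 ↔ reTr M = 0 := by
  refine ⟨fun h' => by simp [reTr, h'], fun h' => by simp [trace_eq_of_isHermitian h, h']⟩

end Trace

/-! ### Hermitian `2 × 2` matrices -/

section TwoByTwo

variable {F : Type*} [NormedDivisionRing F] [InnerProductSpace ℝ F] [StarRing F]

/-- The determinant of a Hermitian `2 × 2` matrix, expressed by traces. -/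
noncomputable def det₂ (M : Matrix (Fin 2) (Fin 2) F) : ℝ := ((reTr M) ^ 2 - reTr (M * M)) / 2

/-- The inverse of a Hermitian `2 × 2` matrix. -/
noncomputable def inv₂ (M : Matrix (Fin 2) (Fin 2) F) : Matrix (Fin 2) (Fin 2) F :=
  (det₂ M)⁻¹ • (reTr M • (1 : Matrix (Fin 2) (Fin 2) F) - M)

variable [IsScalarTower ℝ F F] [SMulCommClass ℝ F F] [IsEuclideanStar F]

lemma hermitian_two_entries {M : Matrix (Fin 2) (Fin 2) F} (h : M.IsHermitian) :
    ∃ (p r : ℝ) (q : F), M = !![p • 1, q; star q, r • 1] := by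
  refine ⟨inner ℝ 1 (M 0 0), inner ℝ 1 (M 1 1), M 0 1, ?_⟩
  rw [← IsEuclideanStar.eq_of_star _ (h.apply 0 0), ← IsEuclideanStar.eq_of_star _ (h.apply 1 1),
    h.apply 1 0]
  exact Matrix.eta_fin_two M

lemma det₂_entries (p r : ℝ) (q : F) :
    det₂ !![p • 1, q; star q, r • 1] = p * r - ‖q‖ ^ 2 := by
  simp [det₂, reTr, Matrix.trace_fin_two, inner_add_right, inner_smul_right,
    IsEuclideanStar.mul_star, IsEuclideanStar.star_mul, smul_smul]
  ring

/-- Cayley–Hamilton. It survives noncommutativity because the diagonal entries are real and the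
off-diagonal entry is only multiplied by reals and by its own conjugate. -/
lemma mul_adjugate_two {M : Matrix (Fin 2) (Fin 2) F} (h : M.IsHermitian) :
    M * (reTr M • 1 - M) = det₂ M • 1 := by
  obtain ⟨p, r, q, rfl⟩ := hermitian_two_entries h
  rw [det₂_entries]
  have ht : reTr !![p • 1, q; star q, r • 1] = p + r := by
    simp [reTr, Matrix.trace_fin_two, inner_add_right, inner_smul_right]
  rw [ht, Matrix.one_fin_two]
  ext i j
  fin_cases i <;> fin_cases j <;>
    simp [Matrix.mul_apply, IsEuclideanStar.mul_star, IsEuclideanStar.star_mul,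
      ← sub_smul, mul_smul_comm] <;>
    module

lemma mul_inv₂ {M : Matrix (Fin 2) (Fin 2) F} (h : M.IsHermitian) (hd : det₂ M ≠ 0) :
    M * inv₂ M = 1 := by
  rw [inv₂, Matrix.mul_smul, mul_adjugate_two h, smul_smul, inv_mul_cancel₀ hd, one_smul]

lemma inv₂_mul {M : Matrix (Fin 2) (Fin 2) F} (h : M.IsHermitian) (hd : det₂ M ≠ 0) :
    inv₂ M * M = 1 := by
  have hc : inv₂ M * M = M * inv₂ M := by
    simp [inv₂, Matrix.mul_smul, Matrix.smul_mul, mul_sub, sub_mul]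
  rw [hc, mul_inv₂ h hd]

variable [StarModule ℝ F]

lemma isHermitian_inv₂ {M : Matrix (Fin 2) (Fin 2) F} (h : M.IsHermitian) :
    (inv₂ M).IsHermitian := by
  rw [Matrix.IsHermitian, inv₂, Matrix.conjTranspose_smul, Matrix.conjTranspose_sub,
    Matrix.conjTranspose_smul, h.eq, Matrix.conjTranspose_one, star_trivial, star_trivial]

/-- If the determinant vanished, cancelling `M` in `mul_adjugate_two` would give `M = reTr M • 1`.
Taking traces, `reTr M = 2 * reTr M`, hence `M = 0`, which is absurd. -/
lemma det₂_ne_zero_of_mul_eq_one {M N : Matrix (Fin 2) (Fin 2) F} (h : M.IsHermitian)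
    (hN : N * M = 1) : det₂ M ≠ 0 := by
  intro hd
  have h₁ := mul_adjugate_two h
  rw [hd, zero_smul] at h₁
  have h₂ : reTr M • (1 : Matrix (Fin 2) (Fin 2) F) - M = 0 := by
    have := congrArg (N * ·) h₁
    simpa only [← mul_assoc, hN, one_mul, mul_zero] using this
  have h₃ := congrArg reTr h₂
  rw [reTr_sub, reTr_smul, reTr_one, reTr_zero] at h₃
  have h₄ : reTr M = 0 := by norm_num at h₃; linarith
  rw [h₄, zero_smul, zero_sub, neg_eq_zero] at h₂
  rw [h₂, mul_zero] at hN
  exact zero_ne_one hN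

/-- A traceless Hermitian `2 × 2` matrix anticommutes with some unitary matrix. -/
lemma exists_unitary_anticommute {M : Matrix (Fin 2) (Fin 2) F} (h : M.IsHermitian)
    (ht : reTr M = 0) : ∃ W : Matrix (Fin 2) (Fin 2) F, W * Wᴴ = 1 ∧ Wᴴ * W = 1 ∧
      W * M = -(M * W) := by
  obtain ⟨p, r, q, rfl⟩ := hermitian_two_entries h
  have hr : r = -p := by
    have : p + r = 0 := by
      simpa [reTr, Matrix.trace_fin_two, inner_add_right, inner_smul_right] using ht
    linarith
  subst hr
  obtain ⟨u, hu, hq⟩ : ∃ u : F, ‖u‖ = 1 ∧ ∃ c : ℝ, q = c • u := by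
    by_cases hq : q = 0
    · exact ⟨1, norm_one, 0, by simp [hq]⟩
    · have : ‖q‖ ≠ 0 := norm_ne_zero_iff.2 hq
      exact ⟨‖q‖⁻¹ • q, by rw [norm_smul]; simp [this], ‖q‖, by simp [smul_smul, this]⟩
  obtain ⟨c, rfl⟩ := hq
  have h₁ : u * star u = 1 := by simp [IsEuclideanStar.mul_star, hu]
  have h₂ : star u * u = 1 := by simp [IsEuclideanStar.star_mul, hu]
  -- A quarter turn adapted to the phase `u` of the off-diagonal entry; the phase is chosen as `1`
  -- when that entry is zero.
  refine ⟨!![0, u; -star u, 0], ?_, ?_, ?_⟩ <;>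
  · ext i j
    fin_cases i <;> fin_cases j <;> simp [Matrix.mul_apply, h₁, h₂, star_smul, mul_smul_comm]

end TwoByTwo

/-! ### Orthonormal frames of Hermitian projections -/

section Projections

variable {F : Type*} [NormedDivisionRing F] [InnerProductSpace ℝ F] [StarRing F] [StarModule ℝ F]
  [IsScalarTower ℝ F F] [SMulCommClass ℝ F F] [IsEuclideanStar F]
variable {n : Type*} [Fintype n]

lemma isHermitian_one_by_one {M : Matrix (Fin 1) (Fin 1) F} (h : M.IsHermitian) :
    M = reTr M • 1 := by
  ext i j
  fin_cases i; fin_cases j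
  have := IsEuclideanStar.eq_of_star _ (h.apply 0 0)
  simpa [reTr, Matrix.trace] using this

/-- Every row of an idempotent is fixed by it, so a nonzero row can be normalized. -/
lemma exists_unit_row {Q : Matrix n n F} (hQ : Q * Q = Q) (ht : reTr Q ≠ 0) :
    ∃ u : Matrix (Fin 1) n F, u * uᴴ = 1 ∧ u * Q = u := by
  obtain ⟨i, hi⟩ : ∃ i, Q.submatrix (fun _ : Fin 1 => i) id ≠ 0 := by
    by_contra! h
    refine ht ?_
    have : Q = 0 := by
      ext i j
      exact congrFun (congrFun (h i) 0) j
    simp [this]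
  set v := Q.submatrix (fun _ : Fin 1 => i) id with hv
  have hvQ : v * Q = v := by
    ext a j
    exact congrFun (congrFun hQ i) j
  have hc : 0 < reTr (v * vᴴ) :=
    (reTr_mul_conjTranspose_self_nonneg v).lt_of_ne fun h =>
      hi (eq_zero_of_reTr_mul_conjTranspose v h.symm)
  have hvv := isHermitian_one_by_one (Matrix.isHermitian_mul_conjTranspose_self v)
  generalize reTr (v * vᴴ) = c at *
  refine ⟨(√c)⁻¹ • v, ?_, by rw [Matrix.smul_mul, hvQ]⟩
  rw [Matrix.conjTranspose_smul, star_trivial, Matrix.smul_mul, Matrix.mul_smul, smul_smul,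
    hvv, smul_smul, ← mul_inv, Real.mul_self_sqrt hc.le, inv_mul_cancel₀ hc.ne', one_smul]

lemma sub_row_mul_self {Q : Matrix n n F} (hQ : Q * Q = Q) (hH : Q.IsHermitian)
    {u : Matrix (Fin 1) n F} (hu : u * uᴴ = 1) (huQ : u * Q = u) :
    (Q - uᴴ * u) * (Q - uᴴ * u) = Q - uᴴ * u := by
  have h₁ : Q * uᴴ = uᴴ := by
    rw [← hH.eq, ← Matrix.conjTranspose_mul, huQ]
  have h₂ : uᴴ * u * (uᴴ * u) = uᴴ * u := by
    rw [Matrix.mul_assoc, ← Matrix.mul_assoc u, hu, Matrix.one_mul]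
  rw [sub_mul, mul_sub, mul_sub, hQ, h₂, ← Matrix.mul_assoc Q, h₁, Matrix.mul_assoc uᴴ u Q, huQ]
  abel

lemma reTr_row {u : Matrix (Fin 1) n F} (hu : u * uᴴ = 1) : reTr (uᴴ * u) = 1 := by
  rw [reTr_mul_comm, hu, reTr_one]
  simp

/-- The trace of a Hermitian projection is its squared norm, so trace zero forces it to vanish. -/
lemma eq_of_reTr_eq_of_sub_mul_self {Q R : Matrix n n F} (hH : (Q - R).IsHermitian)
    (h : (Q - R) * (Q - R) = Q - R) (ht : reTr Q = reTr R) : Q = R := by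
  refine sub_eq_zero.1 (eq_zero_of_reTr_mul_conjTranspose _ ?_)
  rw [hH.eq, h, reTr_sub, ht, sub_self]

/-- A Hermitian projection of rank two comes from an orthonormal frame. -/
lemma exists_frame_of_projection {Q : Matrix n n F} (hQ : Q * Q = Q) (hH : Q.IsHermitian)
    (ht : reTr Q = 2) : ∃ B : Matrix (Fin 2) n F, B * Bᴴ = 1 ∧ Bᴴ * B = Q := by
  obtain ⟨u, hu, huQ⟩ := exists_unit_row hQ (by rw [ht]; norm_num)
  have hR := sub_row_mul_self hQ hH hu huQ
  have hRH : (Q - uᴴ * u).IsHermitian := hH.sub (Matrix.isHermitian_conjTranspose_mul_self u)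
  have hRt : reTr (Q - uᴴ * u) = 1 := by
    rw [reTr_sub, ht, reTr_row hu]
    norm_num
  -- The remaining projection has trace one, so a single further unit row exhausts it.
  obtain ⟨w, hw, hwR⟩ := exists_unit_row hR (by rw [hRt]; norm_num)
  have hR₂ := sub_row_mul_self hR hRH hw hwR
  have hQ₂ : Q - uᴴ * u = wᴴ * w := eq_of_reTr_eq_of_sub_mul_self
    (hRH.sub (Matrix.isHermitian_conjTranspose_mul_self w)) hR₂ (by rw [hRt, reTr_row hw])
  have h₁ : Q * uᴴ = uᴴ := by
    rw [← hH.eq, ← Matrix.conjTranspose_mul, huQ]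
  have hwu : w * uᴴ = 0 := by
    rw [← hwR, Matrix.mul_assoc, Matrix.sub_mul, h₁, Matrix.mul_assoc, hu, Matrix.mul_one, sub_self,
      Matrix.mul_zero]
  have huw : u * wᴴ = 0 := by
    rw [← Matrix.conjTranspose_conjTranspose u, ← Matrix.conjTranspose_mul, hwu,
      Matrix.conjTranspose_zero]
  refine ⟨Matrix.of ![u 0, w 0], ?_, ?_⟩
  · have e₁ := congrFun (congrFun hu 0) 0
    have e₂ := congrFun (congrFun hw 0) 0
    have e₃ := congrFun (congrFun hwu 0) 0
    have e₄ := congrFun (congrFun huw 0) 0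
    rw [Matrix.mul_apply] at e₁ e₂ e₃ e₄
    ext i j
    rw [Matrix.mul_apply]
    fin_cases i <;> fin_cases j
    · exact e₁
    · exact e₄
    · exact e₃
    · exact e₂
  · rw [sub_eq_iff_eq_add] at hQ₂
    rw [hQ₂]
    ext i j
    simp [Matrix.mul_apply, Fin.sum_univ_two, add_comm]

end Projections

/-! ### Splittings -/

section Splittings

variable {F : Type*} [NormedDivisionRing F] [InnerProductSpace ℝ F] [StarRing F] [StarModule ℝ F]
  [IsScalarTower ℝ F F] [SMulCommClass ℝ F F] [IsEuclideanStar F]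

/-- `B` and `C` are orthonormal frames of the eigenspaces of `A` for `½` and `-½`. -/
structure IsSplitting (A : Matrix (Fin 4) (Fin 4) F) (B C : Matrix (Fin 2) (Fin 4) F) : Prop where
  left : B * Bᴴ = 1
  right : C * Cᴴ = 1
  left_right : B * Cᴴ = 0
  right_left : C * Bᴴ = 0
  left_sum : Bᴴ * B = A + (1 / 2 : ℝ) • 1
  right_sum : Cᴴ * C = (1 / 2 : ℝ) • 1 - A

lemma add_half_mul_self {A : Matrix (Fin 4) (Fin 4) F} (h : A * A = (1 / 4 : ℝ) • 1) :
    (A + (1 / 2 : ℝ) • 1) * (A + (1 / 2 : ℝ) • 1) = A + (1 / 2 : ℝ) • 1 := by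
  simp only [add_mul, mul_add, Matrix.mul_smul, Matrix.smul_mul, Matrix.mul_one, Matrix.one_mul, h]
  module

lemma exists_isSplitting {A : Matrix (Fin 4) (Fin 4) F} (hH : A.IsHermitian) (ht : reTr A = 0)
    (h : A * A = (1 / 4 : ℝ) • 1) : ∃ B C, IsSplitting A B C := by
  have h1 : ((1 / 2 : ℝ) • (1 : Matrix (Fin 4) (Fin 4) F)).IsHermitian := by
    rw [Matrix.IsHermitian, Matrix.conjTranspose_smul, Matrix.conjTranspose_one, star_trivial]
  have h2 : reTr ((1 / 2 : ℝ) • (1 : Matrix (Fin 4) (Fin 4) F)) = 2 := by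
    rw [reTr_smul, reTr_one]; norm_num
  obtain ⟨B, hB, hBA⟩ := exists_frame_of_projection (add_half_mul_self h) (hH.add h1)
    (by rw [reTr_add, h2, ht, zero_add])
  -- The same argument for `-A` handles the complementary projection `½ - A`.
  have hneg := add_half_mul_self (A := -A) (by rw [neg_mul_neg, h])
  rw [neg_add_eq_sub] at hneg
  obtain ⟨C, hC, hCA⟩ := exists_frame_of_projection hneg (h1.sub hH)
    (by rw [reTr_sub, h2, ht, sub_zero])
  have hBC : B * Cᴴ = 0 := by
    have e₁ : B * (Bᴴ * B) = B := by rw [← Matrix.mul_assoc, hB, Matrix.one_mul]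
    have e₂ : Cᴴ * C * Cᴴ = Cᴴ := by rw [Matrix.mul_assoc, hC, Matrix.mul_one]
    have e₃ : Bᴴ * B * (Cᴴ * C) = 0 := by
      rw [hBA, hCA]
      simp only [add_mul, mul_sub, Matrix.mul_smul, Matrix.smul_mul, Matrix.mul_one,
        Matrix.one_mul, h]
      module
    rw [← e₁, ← e₂, Matrix.mul_assoc, ← Matrix.mul_assoc (Bᴴ * B), e₃, Matrix.zero_mul,
      Matrix.mul_zero]
  refine ⟨B, C, hB, hC, hBC, ?_, hBA, hCA⟩
  rw [← Matrix.conjTranspose_conjTranspose C, ← Matrix.conjTranspose_mul, hBC,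
    Matrix.conjTranspose_zero]

variable {A : Matrix (Fin 4) (Fin 4) F} {B C : Matrix (Fin 2) (Fin 4) F}

namespace IsSplitting

lemma sum (h : IsSplitting A B C) : Bᴴ * B + Cᴴ * C = 1 := by
  rw [h.left_sum, h.right_sum]
  module

lemma eq (h : IsSplitting A B C) : A = (1 / 2 : ℝ) • (Bᴴ * B - Cᴴ * C) := by
  rw [h.left_sum, h.right_sum]
  module

lemma left_mul (h : IsSplitting A B C) : B * A = (1 / 2 : ℝ) • B := by
  rw [h.eq, Matrix.mul_smul, Matrix.mul_sub, ← Matrix.mul_assoc, ← Matrix.mul_assoc, h.left,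
    h.left_right, Matrix.one_mul, Matrix.zero_mul, sub_zero]

lemma right_mul (h : IsSplitting A B C) : C * A = -((1 / 2 : ℝ) • C) := by
  rw [h.eq, Matrix.mul_smul, Matrix.mul_sub, ← Matrix.mul_assoc, ← Matrix.mul_assoc, h.right,
    h.right_left, Matrix.one_mul, Matrix.zero_mul, zero_sub, smul_neg]

lemma isHermitian (h : IsSplitting A B C) : A.IsHermitian := by
  rw [h.eq, Matrix.IsHermitian]
  simp

lemma mul_left (h : IsSplitting A B C) : A * Bᴴ = (1 / 2 : ℝ) • Bᴴ := by
  have := congrArg Matrix.conjTranspose h.left_mul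
  simpa [h.isHermitian.eq] using this

lemma mul_right (h : IsSplitting A B C) : A * Cᴴ = -((1 / 2 : ℝ) • Cᴴ) := by
  have := congrArg Matrix.conjTranspose h.right_mul
  simpa [h.isHermitian.eq] using this

lemma decompose (h : IsSplitting A B C) (X : Matrix (Fin 4) (Fin 4) F) :
    X = Bᴴ * (B * X * Bᴴ) * B + Bᴴ * (B * X * Cᴴ) * C + (Cᴴ * (C * X * Bᴴ) * B
      + Cᴴ * (C * X * Cᴴ) * C) := by
  conv_lhs => rw [← Matrix.mul_one X, ← Matrix.one_mul (X * 1), ← h.sum]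
  simp only [Matrix.mul_add, Matrix.add_mul, Matrix.mul_assoc]
  abel

/-- On a diagonal block `A` acts from both sides by the same scalar `±½`, so anticommuting kills the
block. -/
lemma eq_of_anticommute (h : IsSplitting A B C) {X : Matrix (Fin 4) (Fin 4) F}
    (hX : A * X + X * A = 0) : X = Bᴴ * (B * X * Cᴴ) * C + Cᴴ * (C * X * Bᴴ) * B := by
  have h₁ : B * X * Bᴴ = 0 := by
    have := congrArg (fun Y => B * Y * Bᴴ) hX
    simp only [Matrix.mul_add, Matrix.add_mul, ← Matrix.mul_assoc, h.left_mul] at this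
    rw [Matrix.mul_assoc (B * X), h.mul_left, Matrix.smul_mul, Matrix.smul_mul, Matrix.mul_smul,
      ← add_smul] at this
    norm_num at this
    exact this
  have h₂ : C * X * Cᴴ = 0 := by
    have := congrArg (fun Y => C * Y * Cᴴ) hX
    simp only [Matrix.mul_add, Matrix.add_mul, ← Matrix.mul_assoc, h.right_mul] at this
    rw [Matrix.mul_assoc (C * X), h.mul_right, Matrix.neg_mul, Matrix.neg_mul, Matrix.smul_mul,
      Matrix.smul_mul, Matrix.mul_neg, Matrix.mul_smul, ← neg_add, ← add_smul] at this
    norm_num at this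
    exact this
  have := h.decompose X
  rw [h₁, h₂] at this
  simpa using this

/-- On an off-diagonal block `A` acts by opposite scalars from the two sides, so commuting kills the
block. -/
lemma eq_of_commute (h : IsSplitting A B C) {X : Matrix (Fin 4) (Fin 4) F}
    (hX : A * X = X * A) : X = Bᴴ * (B * X * Bᴴ) * B + Cᴴ * (C * X * Cᴴ) * C := by
  have h₁ : B * X * Cᴴ = 0 := by
    have := congrArg (fun Y => B * Y * Cᴴ) hX
    simp only [← Matrix.mul_assoc, h.left_mul] at this
    rw [Matrix.mul_assoc (B * X), h.mul_right, Matrix.smul_mul, Matrix.smul_mul, Matrix.mul_neg,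
      Matrix.mul_smul, eq_neg_iff_add_eq_zero, ← add_smul] at this
    norm_num at this
    exact this
  have h₂ : C * X * Bᴴ = 0 := by
    have := congrArg (fun Y => C * Y * Bᴴ) hX
    simp only [← Matrix.mul_assoc, h.right_mul] at this
    rw [Matrix.mul_assoc (C * X), h.mul_left, Matrix.neg_mul, Matrix.neg_mul, Matrix.smul_mul,
      Matrix.smul_mul, Matrix.mul_smul, eq_comm, eq_neg_iff_add_eq_zero, ← add_smul] at this
    norm_num at this
    exact this
  have := h.decompose X
  rw [h₁, h₂] at this
  simpa using this

/-- A Hermitian matrix that commutes with `A` and is orthogonal to `1` and `A` anticommutes with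
some unitary matrix that commutes with `A`. -/
lemma exists_unitary (h : IsSplitting A B C) {X : Matrix (Fin 4) (Fin 4) F} (hH : X.IsHermitian)
    (hX : A * X = X * A) (h₁ : reTr X = 0) (hA : reTr (A * X) = 0) :
    ∃ Q : Matrix (Fin 4) (Fin 4) F, Q * Qᴴ = 1 ∧ Qᴴ * Q = 1 ∧ Q * A = A * Q ∧
      Q * X = -(X * Q) := by
  -- By cyclicity the traces of the two blocks are those of `(½ ± A) * X`, so orthogonality to `1`
  -- and `A` makes each block traceless separately.
  have hB : reTr (B * X * Bᴴ) = 0 := by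
    rw [reTr_mul_comm, ← Matrix.mul_assoc, h.left_sum, Matrix.add_mul, reTr_add, hA,
      Matrix.smul_mul, Matrix.one_mul, reTr_smul, h₁]
    simp
  have hC : reTr (C * X * Cᴴ) = 0 := by
    rw [reTr_mul_comm, ← Matrix.mul_assoc, h.right_sum, Matrix.sub_mul, reTr_sub, hA,
      Matrix.smul_mul, Matrix.one_mul, reTr_smul, h₁]
    simp
  obtain ⟨V, hV, hV', hVX⟩ := exists_unitary_anticommute
    (Matrix.isHermitian_mul_mul_conjTranspose B hH) hB
  obtain ⟨W, hW, hW', hWX⟩ := exists_unitary_anticommute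
    (Matrix.isHermitian_mul_mul_conjTranspose C hH) hC
  have hX' := h.eq_of_commute hX
  generalize B * X * Bᴴ = Y at *
  generalize C * X * Cᴴ = Z at *
  have a₁ : ∀ M : Matrix (Fin 2) (Fin 4) F, B * (Bᴴ * M) = M := fun M => by
    rw [← Matrix.mul_assoc, h.left, Matrix.one_mul]
  have a₂ : ∀ M : Matrix (Fin 2) (Fin 4) F, C * (Cᴴ * M) = M := fun M => by
    rw [← Matrix.mul_assoc, h.right, Matrix.one_mul]
  have a₃ : ∀ M : Matrix (Fin 2) (Fin 4) F, B * (Cᴴ * M) = 0 := fun M => by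
    rw [← Matrix.mul_assoc, h.left_right, Matrix.zero_mul]
  have a₄ : ∀ M : Matrix (Fin 2) (Fin 4) F, C * (Bᴴ * M) = 0 := fun M => by
    rw [← Matrix.mul_assoc, h.right_left, Matrix.zero_mul]
  have b₁ : ∀ M : Matrix (Fin 2) (Fin 4) F, V * (Vᴴ * M) = M := fun M => by
    rw [← Matrix.mul_assoc, hV, Matrix.one_mul]
  have b₂ : ∀ M : Matrix (Fin 2) (Fin 4) F, Vᴴ * (V * M) = M := fun M => by
    rw [← Matrix.mul_assoc, hV', Matrix.one_mul]
  have b₃ : ∀ M : Matrix (Fin 2) (Fin 4) F, W * (Wᴴ * M) = M := fun M => by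
    rw [← Matrix.mul_assoc, hW, Matrix.one_mul]
  have b₄ : ∀ M : Matrix (Fin 2) (Fin 4) F, Wᴴ * (W * M) = M := fun M => by
    rw [← Matrix.mul_assoc, hW', Matrix.one_mul]
  have c₁ : ∀ M : Matrix (Fin 2) (Fin 4) F, V * (Y * M) = -(Y * (V * M)) := fun M => by
    rw [← Matrix.mul_assoc, hVX, Matrix.neg_mul, Matrix.mul_assoc]
  have c₂ : ∀ M : Matrix (Fin 2) (Fin 4) F, W * (Z * M) = -(Z * (W * M)) := fun M => by
    rw [← Matrix.mul_assoc, hWX, Matrix.neg_mul, Matrix.mul_assoc]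
  -- Block diagonal with respect to the eigenspaces of `A`, hence commuting with `A`.
  refine ⟨Bᴴ * V * B + Cᴴ * W * C, ?_, ?_, ?_, ?_⟩
  · simp only [Matrix.conjTranspose_add, Matrix.conjTranspose_mul,
      Matrix.conjTranspose_conjTranspose, Matrix.add_mul, Matrix.mul_add, Matrix.mul_assoc,
      a₁, a₂, a₃, a₄, b₁, b₃, Matrix.mul_zero, add_zero, zero_add, h.sum]
  · simp only [Matrix.conjTranspose_add, Matrix.conjTranspose_mul,
      Matrix.conjTranspose_conjTranspose, Matrix.add_mul, Matrix.mul_add, Matrix.mul_assoc,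
      a₁, a₂, a₃, a₄, b₂, b₄, Matrix.mul_zero, add_zero, zero_add, h.sum]
  · simp only [Matrix.add_mul, Matrix.mul_add, Matrix.mul_assoc _ B, h.left_mul,
      Matrix.mul_assoc _ C, h.right_mul]
    simp only [← Matrix.mul_assoc, h.mul_left, h.mul_right]
    simp
  · rw [hX']
    simp only [Matrix.add_mul, Matrix.mul_add, Matrix.mul_assoc,
      a₁, a₂, a₃, a₄, c₁, c₂, Matrix.mul_zero, add_zero, zero_add, Matrix.mul_neg, neg_add]

end IsSplitting

end Splittings

/-! ### Calculus of matrices -/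

section Calculus

variable {F : Type*} [NormedDivisionRing F] [InnerProductSpace ℝ F] [FiniteDimensional ℝ F]

/-- The real part of the trace as a continuous linear map. -/
noncomputable def reTrCLM (n : Type*) [Fintype n] : Matrix n n F →L[ℝ] ℝ :=
  LinearMap.toContinuousLinearMap
    { toFun := reTr
      map_add' := reTr_add
      map_smul' := fun c M => reTr_smul c M }

@[simp] lemma reTrCLM_apply {n : Type*} [Fintype n] (M : Matrix n n F) :
    reTrCLM n M = reTr M := rfl

variable [IsScalarTower ℝ F F] [SMulCommClass ℝ F F]

lemma isBoundedBilinearMap_matrix_mul (l m n : Type*) [Fintype l] [Fintype m] [Fintype n] :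
    IsBoundedBilinearMap ℝ (fun p : Matrix l m F × Matrix m n F => p.1 * p.2) :=
  (LinearMap.toContinuousBilinearMap
    (LinearMap.mk₂ ℝ (fun (M : Matrix l m F) (N : Matrix m n F) => M * N) Matrix.add_mul
      (fun c M N => Matrix.smul_mul c M N) Matrix.mul_add
      (fun c M N => Matrix.mul_smul M c N))).isBoundedBilinearMap

variable {X : Type*} [NormedAddCommGroup X] [NormedSpace ℝ X]
variable {l m n : Type*} [Fintype l] [Fintype m] [Fintype n]

lemma HasFDerivAt.matrix_mul {f : X → Matrix l m F} {g : X → Matrix m n F}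
    {f' : X →L[ℝ] Matrix l m F} {g' : X →L[ℝ] Matrix m n F} {x : X} (hf : HasFDerivAt f f' x)
    (hg : HasFDerivAt g g' x) : ∃ D : X →L[ℝ] Matrix l n F,
      HasFDerivAt (fun y => f y * g y) D x ∧ ∀ v, D v = f x * g' v + f' v * g x := by
  have h := HasFDerivAt.comp x ((isBoundedBilinearMap_matrix_mul l m n).hasFDerivAt (f x, g x))
    (hf.prodMk hg)
  exact ⟨_, h, fun v => rfl⟩

lemma ContDiffAt.matrix_mul {f : X → Matrix l m F} {g : X → Matrix m n F} {x : X}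
    (hf : ContDiffAt ℝ ∞ f x) (hg : ContDiffAt ℝ ∞ g x) :
    ContDiffAt ℝ ∞ (fun y => f y * g y) x := by
  have h : ContDiff ℝ ∞ (fun p : Matrix l m F × Matrix m n F => p.1 * p.2) :=
    (isBoundedBilinearMap_matrix_mul l m n).contDiff
  exact ContDiffAt.comp x h.contDiffAt (hf.prodMk hg)

end Calculus

/-! ### The critical points of `f₃` in its zero set -/

section Critical

variable {F : Type*} [NormedDivisionRing F] [InnerProductSpace ℝ F] [StarRing F] [StarModule ℝ F]
  [IsScalarTower ℝ F F] [SMulCommClass ℝ F F] [IsEuclideanStar F]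

lemma tracelessHermitian_mem_iff {n : ℕ} {M : Matrix (Fin n) (Fin n) F} :
    M ∈ tracelessHermitian n F ↔ M.IsHermitian ∧ reTr M = 0 :=
  ⟨fun h => ⟨h.1, (trace_eq_zero_iff h.1).1 h.2⟩, fun h => ⟨h.1, (trace_eq_zero_iff h.1).2 h.2⟩⟩

lemma tracelessHermitian_isHermitian {n : ℕ} (A : tracelessHermitian n F) :
    (A : Matrix (Fin n) (Fin n) F).IsHermitian := A.2.1

lemma tracelessHermitian_reTr {n : ℕ} (A : tracelessHermitian n F) :
    reTr (A : Matrix (Fin n) (Fin n) F) = 0 := (tracelessHermitian_mem_iff.1 A.2).2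

lemma tracelessHermitian_inner {n : ℕ} (A B : tracelessHermitian n F) :
    inner ℝ A B = reTr (A.1 * B.1) := by
  rw [Submodule.coe_inner, matrix_inner_eq, (tracelessHermitian_isHermitian B).eq]

variable [FiniteDimensional ℝ F]

/-- The product rule yields three terms, equal by cyclicity of `reTr`. For `n = 4` the index type
`Fin ((4 - 1) / 2)` is `Fin 1`, so `F₃` is the only component. -/
lemma fderiv_oddPowerTraces (A X : tracelessHermitian 4 F) (i : Fin 1) :
    fderiv ℝ (oddPowerTraces 4 F) A X i =
      3 * reTr (A.1 * A.1 * X.1) := by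
  have hc : HasFDerivAt (fun B : tracelessHermitian 4 F => B.1)
      (tracelessHermitian 4 F).subtypeL A := (tracelessHermitian 4 F).subtypeL.hasFDerivAt
  obtain ⟨D, hD, hD'⟩ := hc.matrix_mul hc
  obtain ⟨D₂, hD₂, hD₂'⟩ := hD.matrix_mul hc
  have h₃ := (reTrCLM (F := F) (Fin 4)).hasFDerivAt.comp A hD₂
  have h₄ : HasFDerivAt (oddPowerTraces 4 F)
      (ContinuousLinearMap.pi fun _ : Fin 1 => (reTrCLM (F := F) (Fin 4)).comp D₂) A := by
    rw [hasFDerivAt_pi]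
    intro j
    refine h₃.congr_of_eventuallyEq (Filter.Eventually.of_forall fun B => ?_)
    fin_cases j
    show reTr (B.1 ^ 3) = reTr _
    rw [pow_succ, pow_two]
  have h₅ : fderiv ℝ (oddPowerTraces 4 F) A = _ := h₄.fderiv
  rw [h₅]
  show reTr (D₂ X) = _
  rw [hD₂', hD']
  simp only [reTr_add, Matrix.add_mul]
  show reTr (A.1 * A.1 * X.1) + (reTr (A.1 * X.1 * A.1) + reTr (X.1 * A.1 * A.1)) = _
  rw [reTr_mul_comm (A.1 * X.1), Matrix.mul_assoc X.1, reTr_mul_comm X.1, ← Matrix.mul_assoc]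
  ring

lemma oddPowerTraces_eq_zero_iff (A : tracelessHermitian 4 F) :
    oddPowerTraces 4 F A = 0 ↔
      reTr (A.1 * A.1 * A.1) = 0 := by
  have h : ∀ i, oddPowerTraces 4 F A i = reTr (A.1 * A.1 * A.1) := by
    intro i
    fin_cases i
    show reTr (A.1 ^ 3) = reTr _
    rw [pow_succ, pow_two]
  refine ⟨fun h' => by rw [← h 0, h']; rfl, fun h' => funext fun i => by rw [h i, h']; rfl⟩

lemma mem_criticalZeroSet_iff (A : tracelessHermitian 4 F) :
    A ∈ criticalZeroSet 4 F ↔ A.1 * A.1 = (1 / 4 : ℝ) • 1 := by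
  have hsph : A ∈ Metric.sphere (0 : tracelessHermitian 4 F) 1 ↔
      reTr (A.1 * A.1) = 1 := by
    rw [mem_sphere_zero_iff_norm, ← tracelessHermitian_inner, real_inner_self_eq_norm_sq]
    refine ⟨fun h => by simp [h], fun h => ?_⟩
    exact (sq_eq_sq₀ (norm_nonneg _) zero_le_one).1 (by rw [h, one_pow])
  have hA := tracelessHermitian_isHermitian A
  have htr := tracelessHermitian_reTr A
  have h4 : reTr (1 : Matrix (Fin 4) (Fin 4) F) = 4 := by rw [reTr_one]; norm_num
  constructor
  · rintro ⟨h₁, h₂, h₃⟩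
    rw [hsph] at h₁
    rw [oddPowerTraces_eq_zero_iff] at h₂
    have hYH : (A.1 * A.1 - (1 / 4 : ℝ) • 1).IsHermitian := by
      rw [Matrix.IsHermitian, Matrix.conjTranspose_sub, Matrix.conjTranspose_mul, hA.eq,
        Matrix.conjTranspose_smul, Matrix.conjTranspose_one, star_trivial]
    let Y : tracelessHermitian 4 F := ⟨A.1 * A.1 - (1 / 4 : ℝ) • 1,
      tracelessHermitian_mem_iff.2 ⟨hYH, by rw [reTr_sub, h₁, reTr_smul, h4]; norm_num⟩⟩
    have hYA : inner ℝ A Y = 0 := by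
      rw [tracelessHermitian_inner]
      show reTr (A.1 * (A.1 * A.1 - (1 / 4 : ℝ) • 1)) = 0
      rw [Matrix.mul_sub, ← Matrix.mul_assoc, reTr_sub, h₂, Matrix.mul_smul, Matrix.mul_one,
        reTr_smul, htr]
      norm_num
    have hYmem : Y ∈ (Submodule.span ℝ {A})ᗮ :=
      Submodule.mem_orthogonal_singleton_iff_inner_right.2 hYA
    -- Otherwise multiples of the tangent vector `Y` would already make the differential onto `ℝ`.
    have hdY : reTr (A.1 * A.1 * Y.1) = 0 := by
      by_contra hne
      refine h₃ fun y => ⟨(y 0 / (3 * reTr (A.1 * A.1 * Y.1))) •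
        ⟨Y, hYmem⟩, ?_⟩
      funext i
      refine (fderiv_oddPowerTraces A _ i).trans ?_
      show 3 * reTr (A.1 * A.1 * (_ • Y.1)) = _
      rw [Matrix.mul_smul, reTr_smul]
      have : i = 0 := Subsingleton.elim (α := Fin 1) _ _
      subst this
      field_simp
    have hYY : inner ℝ Y Y = 0 := by
      rw [tracelessHermitian_inner]
      nth_rw 1 [show Y.1 =
        A.1 * A.1 - (1 / 4 : ℝ) • 1 from rfl]
      rw [Matrix.sub_mul, reTr_sub, hdY, Matrix.smul_mul, Matrix.one_mul, reTr_smul,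
        tracelessHermitian_reTr Y]
      norm_num
    have hY0 : Y = 0 := inner_self_eq_zero.1 hYY
    exact sub_eq_zero.1 (congrArg Subtype.val hY0)
  · intro h
    refine ⟨hsph.2 ?_, (oddPowerTraces_eq_zero_iff A).2 ?_, fun hs => ?_⟩
    · rw [h, reTr_smul, h4]; norm_num
    · rw [h, Matrix.smul_mul, Matrix.one_mul, reTr_smul, htr, mul_zero]
    -- With `A² = ¼` the differential at `X` is a multiple of `reTr X = 0`, so the value `1` is not
    -- attained.
    · obtain ⟨X, hX⟩ := hs (fun _ => 1)
      have := congrFun hX (0 : Fin 1)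
      simp only [fderiv_oddPowerTraces] at this
      rw [h, Matrix.smul_mul, Matrix.one_mul, reTr_smul, tracelessHermitian_reTr] at this
      norm_num at this

lemma exists_isSplitting_of_mem {A : tracelessHermitian 4 F} (h : A ∈ criticalZeroSet 4 F) :
    ∃ B C, IsSplitting A.1 B C :=
  exists_isSplitting (tracelessHermitian_isHermitian A) (tracelessHermitian_reTr A)
    ((mem_criticalZeroSet_iff A).1 h)

lemma criticalZeroSet_subset_sphere :
    criticalZeroSet 4 F ⊆ Metric.sphere (0 : tracelessHermitian 4 F) 1 := fun _ h => h.1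

lemma isCompact_criticalZeroSet : IsCompact (criticalZeroSet 4 F) := by
  have : ProperSpace (tracelessHermitian 4 F) := FiniteDimensional.proper ℝ _
  have hset : criticalZeroSet 4 F =
      (fun A : tracelessHermitian 4 F => A.1 * A) ⁻¹'
        {(1 / 4 : ℝ) • 1} := by
    ext A
    exact mem_criticalZeroSet_iff A
  have hcont : Continuous
      (fun A : tracelessHermitian 4 F => A.1 * A) :=
    (isBoundedBilinearMap_matrix_mul (Fin 4) (Fin 4) (Fin 4)).continuous.comp
      (continuous_subtype_val.prodMk continuous_subtype_val)
  have hclosed : IsClosed (criticalZeroSet 4 F) := by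
    rw [hset]
    exact isClosed_singleton.preimage hcont
  exact (isCompact_sphere (0 : tracelessHermitian 4 F) 1).of_isClosed_subset hclosed
    criticalZeroSet_subset_sphere

/-! ### The orbit -/

lemma halfDiag_mul_self : halfDiag F * halfDiag F = (1 / 4 : ℝ) • 1 := by
  rw [halfDiag, Matrix.smul_mul, Matrix.mul_smul, smul_smul, Matrix.diagonal_mul_diagonal,
    ← Matrix.diagonal_one]
  norm_num
  ext i
  fin_cases i <;> simp

lemma mem_criticalZeroSet_of_conjugate {P : Matrix (Fin 4) (Fin 4) F} (h : P * Pᴴ = 1)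
    (h' : Pᴴ * P = 1) {A : tracelessHermitian 4 F}
    (hA : (A : Matrix (Fin 4) (Fin 4) F) = Pᴴ * halfDiag F * P) : A ∈ criticalZeroSet 4 F := by
  rw [mem_criticalZeroSet_iff, hA]
  calc Pᴴ * halfDiag F * P * (Pᴴ * halfDiag F * P)
      = Pᴴ * halfDiag F * (P * Pᴴ) * halfDiag F * P := by simp only [Matrix.mul_assoc]
    _ = Pᴴ * (halfDiag F * halfDiag F) * P := by
      rw [h, Matrix.mul_one]
      simp only [Matrix.mul_assoc]
    _ = (1 / 4 : ℝ) • 1 := by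
      rw [halfDiag_mul_self, Matrix.mul_smul, Matrix.mul_one, Matrix.smul_mul, h']

lemma exists_conjugate {A : tracelessHermitian 4 F} (h : A ∈ criticalZeroSet 4 F) :
    ∃ P : Matrix (Fin 4) (Fin 4) F, P * Pᴴ = 1 ∧ Pᴴ * P = 1 ∧
      (A : Matrix (Fin 4) (Fin 4) F) = Pᴴ * halfDiag F * P := by
  obtain ⟨B, C, hs⟩ := exists_isSplitting_of_mem h
  -- The two frames are interleaved to match the signs `1, -1, 1, -1`.
  refine ⟨Matrix.of ![B 0, C 0, B 1, C 1], ?_, ?_, ?_⟩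
  · have e₁ := fun i j => congrFun (congrFun hs.left i) j
    have e₂ := fun i j => congrFun (congrFun hs.right i) j
    have e₃ := fun i j => congrFun (congrFun hs.left_right i) j
    have e₄ := fun i j => congrFun (congrFun hs.right_left i) j
    simp only [Matrix.mul_apply] at e₁ e₂ e₃ e₄
    ext i j
    rw [Matrix.mul_apply]
    fin_cases i <;> fin_cases j
    exacts [e₁ 0 0, e₃ 0 0, e₁ 0 1, e₃ 0 1, e₄ 0 0, e₂ 0 0, e₄ 0 1, e₂ 0 1, e₁ 1 0, e₃ 1 0,
      e₁ 1 1, e₃ 1 1, e₄ 1 0, e₂ 1 0, e₄ 1 1, e₂ 1 1]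
  · rw [← hs.sum]
    ext i j
    simp [Matrix.mul_apply, Fin.sum_univ_four]
    abel
  · rw [hs.eq, halfDiag, Matrix.mul_smul, Matrix.smul_mul]
    congr 1
    ext i j
    simp [Matrix.mul_apply, Fin.sum_univ_four]
    abel

lemma criticalZeroSet_eq_orbit : criticalZeroSet 4 F =
    conjugationOrbit (unitary (Matrix (Fin 4) (Fin 4) F)) (halfDiag F) := by
  ext A
  refine ⟨fun h => ?_, ?_⟩
  · obtain ⟨P, h₁, h₂, hA⟩ := exists_conjugate h
    exact ⟨P, Unitary.mem_iff.2 ⟨h₂, h₁⟩, hA⟩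
  · rintro ⟨P, hP, hA⟩
    exact mem_criticalZeroSet_of_conjugate (Unitary.mem_iff.1 hP).2 (Unitary.mem_iff.1 hP).1 hA

end Critical

lemma criticalZeroSet_real_eq_orbit : criticalZeroSet 4 ℝ =
    conjugationOrbit (Matrix.specialOrthogonalGroup (Fin 4) ℝ) (halfDiag ℝ) := by
  rw [criticalZeroSet_eq_orbit]
  ext A
  refine ⟨?_, ?_⟩
  · rintro ⟨P, hP, hA⟩
    have hP' : P ∈ Matrix.orthogonalGroup (Fin 4) ℝ := hP
    have hdet : P.det * P.det = 1 := by
      have := congrArg Matrix.det (Unitary.mem_iff.1 hP).2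
      rw [Matrix.det_mul, Matrix.star_eq_conjTranspose, Matrix.det_conjTranspose, star_trivial,
        Matrix.det_one] at this
      exact this
    rcases mul_self_eq_one_iff.1 hdet with h | h
    · exact ⟨P, Matrix.mem_specialOrthogonalGroup_iff.2 ⟨hP', h⟩, hA⟩
    -- A reflection commuting with `halfDiag` corrects the determinant without changing the
    -- conjugate.
    · set R : Matrix (Fin 4) (Fin 4) ℝ := Matrix.diagonal ![-1, 1, 1, 1] with hR
      have hRt : Rᴴ = R := by
        rw [hR, Matrix.diagonal_conjTranspose, star_trivial]
      have hRR : R * R = 1 := by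
        rw [hR, Matrix.diagonal_mul_diagonal, ← Matrix.diagonal_one]
        congr 1
        funext i
        fin_cases i <;> simp
      have hRD : R * halfDiag ℝ * R = halfDiag ℝ := by
        rw [hR, halfDiag, Matrix.mul_smul, Matrix.smul_mul, Matrix.diagonal_mul_diagonal,
          Matrix.diagonal_mul_diagonal]
        congr 2
        funext i
        fin_cases i <;> simp
      refine ⟨R * P, Matrix.mem_specialOrthogonalGroup_iff.2 ⟨mul_mem ?_ hP', ?_⟩, ?_⟩
      · refine Unitary.mem_iff.2 ⟨?_, ?_⟩ <;> rw [Matrix.star_eq_conjTranspose, hRt, hRR]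
      · rw [Matrix.det_mul, h, hR, Matrix.det_diagonal]
        simp [Fin.prod_univ_four]
      · rw [hA, Matrix.conjTranspose_mul, hRt]
        nth_rw 1 [← hRD]
        simp only [Matrix.mul_assoc]
  · rintro ⟨P, hP, hA⟩
    exact ⟨P, (Matrix.mem_specialOrthogonalGroup_iff.1 hP).1, hA⟩

/-! ### Symmetry of the principal curvatures -/

section PrincipalCurvatures

lemma charpoly_neg_eq {k : ℕ} (S : Matrix (Fin k) (Fin k) ℝ) :
    (-S).charpoly = (-1) ^ k * S.charpoly.comp (-Polynomial.X) := by
  have h : Matrix.charmatrix (-S) =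
      -((Polynomial.compRingHom (-Polynomial.X)).mapMatrix (Matrix.charmatrix S)) := by
    ext i j : 2
    rcases eq_or_ne i j with rfl | hij
    · simp [Matrix.charmatrix_apply_eq]
      ring
    · simp [Matrix.charmatrix_apply_ne _ _ _ hij]
  rw [Matrix.charpoly, h, Matrix.det_neg, ← RingHom.map_det, Fintype.card_fin,
    Polynomial.coe_compRingHom_apply, Matrix.charpoly]

/-- Substituting `-X` negates the roots, and the sign `(-1) ^ k` does not affect them. -/
lemma roots_charpoly_neg {k : ℕ} (S : Matrix (Fin k) (Fin k) ℝ) :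
    (-S).charpoly.roots = S.charpoly.roots.map fun c => -c := by
  rw [charpoly_neg_eq, ← Polynomial.roots_comp_neg_X]
  rcases neg_one_pow_eq_or (Polynomial ℝ) k with h | h <;> simp [h]

lemma gram_transform {E : Type*} [AddCommGroup E] [Module ℝ E] {k : ℕ}
    (β : E →ₗ[ℝ] E →ₗ[ℝ] ℝ) (d d' : Fin k → E) (M : Matrix (Fin k) (Fin k) ℝ)
    (h : ∀ i, d' i = ∑ a, M a i • d a) :
    (Matrix.of fun i j => β (d' i) (d' j)) = Mᵀ * (Matrix.of fun i j => β (d i) (d j)) * M := by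
  ext i j
  simp only [Matrix.of_apply, h, map_sum, map_smul, LinearMap.sum_apply, LinearMap.smul_apply,
    smul_eq_mul, Matrix.mul_apply, Matrix.transpose_apply]
  refine Finset.sum_congr rfl fun b _ => ?_
  rw [mul_comm]

variable {E : Type*} [NormedAddCommGroup E] [InnerProductSpace ℝ E]

/-- If a linear isometry preserves the tangent space and reverses the sign of the second
fundamental form, then the principal curvatures are symmetric about zero. -/
lemma principalCurvatures_map_neg {k : ℕ} {φ : EuclideanSpace ℝ (Fin k) → E}
    {x : EuclideanSpace ℝ (Fin k)} {ξ : E} (hinj : Function.Injective (fderiv ℝ φ x))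
    (J : E →ₗ[ℝ] E) (hJ : ∀ v ∈ tangentSpaceOf φ x, J v ∈ tangentSpaceOf φ x)
    (hJi : ∀ v w, inner ℝ (J v) (J w) = inner ℝ v w) (H : E →ₗ[ℝ] E →ₗ[ℝ] ℝ)
    (hH : ∀ u v : EuclideanSpace ℝ (Fin k), inner ℝ (fderiv ℝ (fderiv ℝ φ) x u v) ξ
      = H (fderiv ℝ φ x u) (fderiv ℝ φ x v))
    (hHJ : ∀ v w, H (J v) (J w) = -H v w) :
    (principalCurvatures φ x ξ).map (fun c => -c) = principalCurvatures φ x ξ := by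
  set d : Fin k → E := fun i => fderiv ℝ φ x (EuclideanSpace.single i 1) with hd
  have hdv : ∀ m : EuclideanSpace ℝ (Fin k), fderiv ℝ φ x m = ∑ a, m a • d a := by
    intro m
    conv_lhs => rw [← (EuclideanSpace.basisFun (Fin k) ℝ).sum_repr m]
    simp [hd]
  have hm : ∀ i, ∃ m : EuclideanSpace ℝ (Fin k), fderiv ℝ φ x m = J (d i) := fun i =>
    hJ (d i) ⟨EuclideanSpace.single i 1, rfl⟩
  choose m hm using hm
  -- The matrix of `J` on the tangent space in the coordinate basis: `J` preserves `g` and negates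
  -- `h`.
  set M : Matrix (Fin k) (Fin k) ℝ := Matrix.of fun a i => m i a with hM
  have hJd : ∀ i, J (d i) = ∑ a, M a i • d a := fun i => by rw [← hm, hdv]; rfl
  set g := firstFormMatrix φ x with hg
  set h := secondFormMatrix φ x ξ with hh
  have hg' : g = Matrix.of fun i j => innerₗ E (d i) (d j) := rfl
  have hh' : h = Matrix.of fun i j => H (d i) (d j) := by
    ext i j
    exact hH _ _
  have e₁ : Mᵀ * g * M = g := by
    rw [hg', ← gram_transform (innerₗ E) d (fun i => J (d i)) M hJd]
    ext i j
    exact hJi _ _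
  have e₂ : Mᵀ * h * M = -h := by
    rw [hh', ← gram_transform H d (fun i => J (d i)) M hJd]
    ext i j
    exact hHJ _ _
  have hli : LinearIndependent ℝ d := by
    have := (EuclideanSpace.basisFun (Fin k) ℝ).toBasis.linearIndependent.map'
      (fderiv ℝ φ x : EuclideanSpace ℝ (Fin k) →ₗ[ℝ] E) (LinearMap.ker_eq_bot.2 hinj)
    have hd' : d = (fderiv ℝ φ x : EuclideanSpace ℝ (Fin k) →ₗ[ℝ] E) ∘
        (EuclideanSpace.basisFun (Fin k) ℝ).toBasis := by
      funext i
      simp [hd]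
    rw [hd']
    exact this
  have hgd : IsUnit g.det := (Matrix.posDef_gram_of_linearIndependent hli).det_pos.ne'.isUnit
  have hMd : IsUnit M.det := by
    have := congrArg Matrix.det e₁
    rw [Matrix.det_mul, Matrix.det_mul, Matrix.det_transpose] at this
    refine isUnit_iff_ne_zero.2 fun h0 => hgd.ne_zero ?_
    rw [← this, h0, mul_zero]
  have hMu : IsUnit M := (Matrix.isUnit_iff_isUnit_det M).2 hMd
  have hMgd : IsUnit (Mᵀ * g).det := by
    rw [Matrix.det_mul, Matrix.det_transpose]
    exact hMd.mul hgd
  set S := shapeOperatorMatrix φ x ξ with hS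
  have hS' : g * S = h := Matrix.mul_nonsing_inv_cancel_left _ _ hgd
  -- Since `g * S = h`, the relations `Mᵀ * g * M = g` and `Mᵀ * h * M = -h` agree after
  -- multiplication by the invertible `Mᵀ * g`.
  have hcomm : S * M = -(M * S) := by
    have : Mᵀ * g * (S * M) = Mᵀ * g * (-(M * S)) := by
      rw [mul_neg, ← mul_assoc, mul_assoc Mᵀ, hS', e₂, ← mul_assoc, e₁, hS']
    have h' := congrArg ((Mᵀ * g)⁻¹ * ·) this
    simpa only [Matrix.nonsing_inv_mul_cancel_left _ _ hMgd] using h'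
  have hchar : (-S).charpoly = S.charpoly := by
    obtain ⟨u, hu⟩ := hMu
    rw [← Matrix.charpoly_units_conj' u S, hu]
    congr 1
    rw [mul_assoc, hcomm, mul_neg, ← mul_assoc, ← hu, Matrix.nonsing_inv_mul _ (hu ▸ hMd),
      one_mul]
  rw [principalCurvatures, ← roots_charpoly_neg, hchar]

end PrincipalCurvatures

/-! ### Tangent and normal vectors of the critical set -/

section Tangent

variable {F : Type*} [NormedDivisionRing F] [InnerProductSpace ℝ F] [StarRing F] [StarModule ℝ F]
  [IsScalarTower ℝ F F] [SMulCommClass ℝ F F] [IsEuclideanStar F]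

/-- The traceless Hermitian matrices that anticommute with `A`. -/
def anticommutant (A : Matrix (Fin 4) (Fin 4) F) : Submodule ℝ (tracelessHermitian 4 F) where
  carrier := {X | A * X.1 + X.1 * A = 0}
  add_mem' := by
    intro X Y (hX : A * X.1 + X.1 * A = 0) (hY : A * Y.1 + Y.1 * A = 0)
    have : A * (X.1 + Y.1) + (X.1 + Y.1) * A = (A * X.1 + X.1 * A) + (A * Y.1 + Y.1 * A) := by
      rw [mul_add, add_mul]; abel
    show A * (X.1 + Y.1) + (X.1 + Y.1) * A = 0
    rw [this, hX, hY, add_zero]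
  zero_mem' := by simp
  smul_mem' := by
    intro c X (hX : A * X.1 + X.1 * A = 0)
    show A * (c • X.1) + (c • X.1) * A = 0
    rw [Matrix.mul_smul, Matrix.smul_mul, ← smul_add, hX, smul_zero]

lemma mem_anticommutant {A : Matrix (Fin 4) (Fin 4) F} {X : tracelessHermitian 4 F} :
    X ∈ anticommutant A ↔ A * X.1 + X.1 * A = 0 := Iff.rfl

/-- Conjugation by a unitary matrix. -/
def unitaryConj (Q : Matrix (Fin 4) (Fin 4) F) (hQ : Qᴴ * Q = 1) :
    tracelessHermitian 4 F →ₗ[ℝ] tracelessHermitian 4 F where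
  toFun X := ⟨Q * X.1 * Qᴴ, tracelessHermitian_mem_iff.2
    ⟨Matrix.isHermitian_mul_mul_conjTranspose Q (tracelessHermitian_isHermitian X), by
      rw [reTr_mul_comm, ← Matrix.mul_assoc, hQ, Matrix.one_mul, tracelessHermitian_reTr]⟩⟩
  map_add' X Y := Subtype.ext (by
    show Q * (X.1 + Y.1) * Qᴴ = Q * X.1 * Qᴴ + Q * Y.1 * Qᴴ
    rw [Matrix.mul_add, Matrix.add_mul])
  map_smul' c X := Subtype.ext (by
    show Q * (c • X.1) * Qᴴ = c • (Q * X.1 * Qᴴ)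
    rw [Matrix.mul_smul, Matrix.smul_mul])

lemma unitaryConj_mul {Q : Matrix (Fin 4) (Fin 4) F} (hQ : Qᴴ * Q = 1)
    (X Y : tracelessHermitian 4 F) :
    (unitaryConj Q hQ X).1 * (unitaryConj Q hQ Y).1 = Q * (X.1 * Y.1) * Qᴴ := by
  show Q * X.1 * Qᴴ * (Q * Y.1 * Qᴴ) = _
  calc Q * X.1 * Qᴴ * (Q * Y.1 * Qᴴ) = Q * X.1 * (Qᴴ * Q) * Y.1 * Qᴴ := by
        simp only [Matrix.mul_assoc]
    _ = _ := by
      rw [hQ, Matrix.mul_one]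
      simp only [Matrix.mul_assoc]

lemma inner_unitaryConj {Q : Matrix (Fin 4) (Fin 4) F} (hQ : Qᴴ * Q = 1)
    (X Y : tracelessHermitian 4 F) :
    inner ℝ (unitaryConj Q hQ X) (unitaryConj Q hQ Y) = inner ℝ X Y := by
  rw [tracelessHermitian_inner, tracelessHermitian_inner, unitaryConj_mul, reTr_mul_comm,
    ← Matrix.mul_assoc, hQ, Matrix.one_mul]

/-- The second fundamental form at `A` of the set of `A` with `A² = ¼` in the normal direction
`ξ`. -/
noncomputable def secondForm (A ξ : Matrix (Fin 4) (Fin 4) F) :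
    tracelessHermitian 4 F →ₗ[ℝ] tracelessHermitian 4 F →ₗ[ℝ] ℝ :=
  LinearMap.mk₂ ℝ (fun X Y => -2 * reTr ((X.1 * Y.1 + Y.1 * X.1) * (A * ξ)))
    (fun X Y Z => by
      simp only [Submodule.coe_add, Matrix.add_mul, Matrix.mul_add, reTr_add]
      ring)
    (fun c X Y => by
      simp [Matrix.smul_mul, Matrix.mul_smul, ← smul_add, reTr_smul]
      ring)
    (fun X Y Z => by
      simp only [Submodule.coe_add, Matrix.add_mul, Matrix.mul_add, reTr_add]
      ring)
    (fun c X Y => by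
      simp [Matrix.smul_mul, Matrix.mul_smul, ← smul_add, reTr_smul]
      ring)

lemma secondForm_apply (A ξ : Matrix (Fin 4) (Fin 4) F) (X Y : tracelessHermitian 4 F) :
    secondForm A ξ X Y = -2 * reTr ((X.1 * Y.1 + Y.1 * X.1) * (A * ξ)) := rfl

/-- Moving `Q` around the trace replaces `A * ξ` by `Qᴴ * (A * ξ) * Q = -(A * ξ)`. -/
lemma secondForm_unitaryConj {A ξ Q : Matrix (Fin 4) (Fin 4) F} (hQ : Qᴴ * Q = 1)
    (hA : Q * A = A * Q) (hξ : Q * ξ = -(ξ * Q)) (X Y : tracelessHermitian 4 F) :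
    secondForm A ξ (unitaryConj Q hQ X) (unitaryConj Q hQ Y) = -secondForm A ξ X Y := by
  have h : Qᴴ * (A * ξ * Q) = -(A * ξ) := by
    have : A * ξ * Q = -(Q * (A * ξ)) := by
      rw [← Matrix.mul_assoc, hA, Matrix.mul_assoc, Matrix.mul_assoc, hξ, Matrix.mul_neg, neg_neg]
    rw [this, Matrix.mul_neg, ← Matrix.mul_assoc, hQ, Matrix.one_mul]
  rw [secondForm_apply, secondForm_apply, unitaryConj_mul, unitaryConj_mul, ← Matrix.add_mul,
    ← Matrix.mul_add, Matrix.mul_assoc, Matrix.mul_assoc, reTr_mul_comm, Matrix.mul_assoc,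
    Matrix.mul_assoc, h, Matrix.mul_neg, reTr_neg, mul_neg]

/-- Normal vectors commute with the base point. -/
lemma commute_of_orthogonal_anticommutant {A ξ : tracelessHermitian 4 F}
    (hA : A.1 * A.1 = (1 / 4 : ℝ) • 1) (hξ : ∀ X ∈ anticommutant A.1, inner ℝ X ξ = 0) :
    A.1 * ξ.1 = ξ.1 * A.1 := by
  have hAH := (tracelessHermitian_isHermitian A).eq
  have hξH := (tracelessHermitian_isHermitian ξ).eq
  -- As `2A` is an involution, this is twice the anticommuting part of `ξ`. It is tangent, hence
  -- orthogonal to `ξ`, and this forces it to vanish.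
  have hYm : ξ.1 - (4 : ℝ) • (A.1 * ξ.1 * A.1) ∈ tracelessHermitian 4 F := by
    refine tracelessHermitian_mem_iff.2 ⟨?_, ?_⟩
    · rw [Matrix.IsHermitian, Matrix.conjTranspose_sub, Matrix.conjTranspose_smul,
        Matrix.conjTranspose_mul, Matrix.conjTranspose_mul, hAH, hξH, star_trivial,
        Matrix.mul_assoc]
    · rw [reTr_sub, reTr_smul, reTr_mul_comm, ← Matrix.mul_assoc, hA, Matrix.smul_mul,
        Matrix.one_mul, reTr_smul, tracelessHermitian_reTr]
      norm_num
  set Y : tracelessHermitian 4 F := ⟨_, hYm⟩ with hY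
  have hY1 : Y.1 = ξ.1 - (4 : ℝ) • (A.1 * ξ.1 * A.1) := rfl
  have e₁ : A.1 * (A.1 * ξ.1 * A.1) = (1 / 4 : ℝ) • (ξ.1 * A.1) := by
    rw [← Matrix.mul_assoc, ← Matrix.mul_assoc, hA]
    simp
  have e₂ : A.1 * ξ.1 * A.1 * A.1 = (1 / 4 : ℝ) • (A.1 * ξ.1) := by
    rw [Matrix.mul_assoc, hA]
    simp
  have hYA : A.1 * Y.1 + Y.1 * A.1 = 0 := by
    rw [hY1, Matrix.mul_sub, Matrix.sub_mul, Matrix.mul_smul, Matrix.smul_mul, e₁, e₂]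
    module
  have hAYA : A.1 * Y.1 * A.1 = -((1 / 4 : ℝ) • Y.1) := by
    rw [eq_neg_of_add_eq_zero_left hYA, Matrix.neg_mul, Matrix.mul_assoc, hA]
    simp
  have hYξ : reTr (Y.1 * ξ.1) = 0 := by
    rw [← tracelessHermitian_inner]
    exact hξ Y hYA
  have hYY : inner ℝ Y Y = 0 := by
    rw [tracelessHermitian_inner]
    nth_rw 2 [hY1]
    rw [Matrix.mul_sub, reTr_sub, hYξ, Matrix.mul_smul, reTr_smul, Matrix.mul_assoc A.1,
      ← Matrix.mul_assoc, reTr_mul_comm, Matrix.mul_assoc, ← Matrix.mul_assoc A.1, reTr_mul_comm,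
      hAYA, Matrix.neg_mul, reTr_neg, Matrix.smul_mul, reTr_smul, hYξ]
    norm_num
  have hY0 : ξ.1 = (4 : ℝ) • (A.1 * ξ.1 * A.1) :=
    sub_eq_zero.1 (congrArg Subtype.val (inner_self_eq_zero.1 hYY : Y = 0))
  conv_lhs => rw [hY0, Matrix.mul_smul, e₁, smul_smul]
  norm_num

variable [FiniteDimensional ℝ F]

/-- A Hermitian matrix anticommuting with `A` is determined by one off-diagonal block, the other
being its conjugate transpose. -/
lemma finrank_anticommutant_le {A : Matrix (Fin 4) (Fin 4) F} {B C : Matrix (Fin 2) (Fin 4) F}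
    (h : IsSplitting A B C) : Module.finrank ℝ (anticommutant A) ≤
      Module.finrank ℝ (Matrix (Fin 2) (Fin 2) F) := by
  let L : anticommutant A →ₗ[ℝ] Matrix (Fin 2) (Fin 2) F :=
    { toFun := fun X => B * X.1.1 * Cᴴ
      map_add' := fun X Y => by
        show B * (X.1.1 + Y.1.1) * Cᴴ = _
        rw [Matrix.mul_add, Matrix.add_mul]
      map_smul' := fun c X => by
        show B * (c • X.1.1) * Cᴴ = _
        rw [Matrix.mul_smul, Matrix.smul_mul]
        rfl }
  refine LinearMap.finrank_le_finrank_of_injective (f := L) ?_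
  intro X₁ X₂ h₁₂
  have h₁ : B * (X₁ - X₂).1.1 * Cᴴ = 0 := by
    show B * (X₁.1.1 - X₂.1.1) * Cᴴ = 0
    rw [Matrix.mul_sub, Matrix.sub_mul, sub_eq_zero]
    exact h₁₂
  rw [← sub_eq_zero]
  generalize X₁ - X₂ = X at *
  have h₂ : C * X.1.1 * Bᴴ = 0 := by
    have := congrArg Matrix.conjTranspose h₁
    rw [Matrix.conjTranspose_mul, Matrix.conjTranspose_mul, Matrix.conjTranspose_conjTranspose,
      (tracelessHermitian_isHermitian X.1).eq, Matrix.conjTranspose_zero] at this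
    rw [Matrix.mul_assoc, this]
  refine Subtype.ext (Subtype.ext ?_)
  rw [h.eq_of_anticommute (X := X.1.1) X.2, h₁, h₂]
  simp

variable {V : Type*} [NormedAddCommGroup V] [NormedSpace ℝ V]

lemma fderiv_mem_anticommutant {U : Set V} (hU : IsOpen U) {φ : V → tracelessHermitian 4 F}
    (hφ : DifferentiableOn ℝ φ U) {c : Matrix (Fin 4) (Fin 4) F}
    (hc : ∀ y ∈ U, (φ y).1 * (φ y).1 = c) {x : V} (hx : x ∈ U) (v : V) :
    fderiv ℝ φ x v ∈ anticommutant (φ x).1 := by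
  have h₁ : HasFDerivAt (fun y => (φ y).1)
      ((tracelessHermitian 4 F).subtypeL.comp (fderiv ℝ φ x)) x :=
    (tracelessHermitian 4 F).subtypeL.hasFDerivAt.comp x
      ((hφ x hx).differentiableAt (hU.mem_nhds hx)).hasFDerivAt
  obtain ⟨D, hD, hDv⟩ := h₁.matrix_mul h₁
  have h₂ : HasFDerivAt (fun y => (φ y).1 * (φ y).1) (0 : V →L[ℝ] Matrix (Fin 4) (Fin 4) F) x :=
    (hasFDerivAt_const c x).congr_of_eventuallyEq
      (Filter.eventually_of_mem (hU.mem_nhds hx) hc)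
  have := hDv v
  rw [hD.unique h₂] at this
  exact this.symm

lemma second_fderiv_relation {U : Set V} (hU : IsOpen U) {φ : V → tracelessHermitian 4 F}
    (hφ : ContDiffOn ℝ ∞ φ U) {c : Matrix (Fin 4) (Fin 4) F}
    (hc : ∀ y ∈ U, (φ y).1 * (φ y).1 = c) {x : V} (hx : x ∈ U) (u v : V) :
    (φ x).1 * (fderiv ℝ (fderiv ℝ φ) x u v).1 + (fderiv ℝ (fderiv ℝ φ) x u v).1 * (φ x).1 =
      -((fderiv ℝ φ x u).1 * (fderiv ℝ φ x v).1 + (fderiv ℝ φ x v).1 * (fderiv ℝ φ x u).1) := by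
  have hd : DifferentiableOn ℝ φ U := hφ.differentiableOn (by simp)
  have h₁ : HasFDerivAt (fun y => (φ y).1)
      ((tracelessHermitian 4 F).subtypeL.comp (fderiv ℝ φ x)) x :=
    (tracelessHermitian 4 F).subtypeL.hasFDerivAt.comp x
      ((hd x hx).differentiableAt (hU.mem_nhds hx)).hasFDerivAt
  have h₂ : DifferentiableAt ℝ (fderiv ℝ φ) x :=
    ((hφ.contDiffAt (hU.mem_nhds hx)).fderiv_right (m := 1) (by norm_cast)).differentiableAt
      one_ne_zero
  have h₃ : HasFDerivAt (fun y => (fderiv ℝ φ y v).1)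
      ((tracelessHermitian 4 F).subtypeL.comp ((fderiv ℝ (fderiv ℝ φ) x).flip v)) x := by
    refine (tracelessHermitian 4 F).subtypeL.hasFDerivAt.comp x ?_
    refine (h₂.hasFDerivAt.clm_apply (hasFDerivAt_const v x)).congr_fderiv ?_
    refine ContinuousLinearMap.ext fun w => ?_
    show fderiv ℝ φ x 0 + _ = _
    rw [map_zero, zero_add]
    rfl
  obtain ⟨D, hD, hDv⟩ := h₁.matrix_mul h₃
  obtain ⟨D', hD', hDv'⟩ := h₃.matrix_mul h₁
  have h₄ : HasFDerivAt
      (fun y => (φ y).1 * (fderiv ℝ φ y v).1 + (fderiv ℝ φ y v).1 * (φ y).1)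
      (0 : V →L[ℝ] Matrix (Fin 4) (Fin 4) F) x :=
    (hasFDerivAt_const 0 x).congr_of_eventuallyEq
      (Filter.eventually_of_mem (hU.mem_nhds hx) fun y hy =>
        fderiv_mem_anticommutant hU hd hc hy v)
  have h₅ := congrArg (fun L : V →L[ℝ] Matrix (Fin 4) (Fin 4) F => L u)
    ((hD.add hD').unique h₄)
  have h₆ : D u + D' u = 0 := h₅
  rw [hDv, hDv'] at h₆
  have h₇ : (φ x).1 * (fderiv ℝ (fderiv ℝ φ) x u v).1 +
      (fderiv ℝ φ x u).1 * (fderiv ℝ φ x v).1 + ((fderiv ℝ φ x v).1 * (fderiv ℝ φ x u).1 +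
      (fderiv ℝ (fderiv ℝ φ) x u v).1 * (φ x).1) = 0 := h₆
  rw [eq_neg_iff_add_eq_zero, ← h₇]
  abel

/-- Multiply the twice differentiated equation by `A * ξ` and take traces: each term on the left
becomes `¼ Re tr (D ξ)`. -/
lemma inner_second_fderiv {A ξ D X Y : tracelessHermitian 4 F}
    (hA : A.1 * A.1 = (1 / 4 : ℝ) • 1) (hξ : A.1 * ξ.1 = ξ.1 * A.1)
    (h : A.1 * D.1 + D.1 * A.1 = -(X.1 * Y.1 + Y.1 * X.1)) :
    inner ℝ D ξ = secondForm A.1 ξ.1 X Y := by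
  have h₁ : reTr (A.1 * D.1 * (A.1 * ξ.1)) = 1 / 4 * reTr (D.1 * ξ.1) := by
    rw [Matrix.mul_assoc, reTr_mul_comm, hξ, Matrix.mul_assoc, Matrix.mul_assoc, hA,
      Matrix.mul_smul, Matrix.mul_one, Matrix.mul_smul, reTr_smul]
  have h₂ : reTr (D.1 * A.1 * (A.1 * ξ.1)) = 1 / 4 * reTr (D.1 * ξ.1) := by
    rw [Matrix.mul_assoc, ← Matrix.mul_assoc A.1, hA, Matrix.smul_mul, Matrix.one_mul,
      Matrix.mul_smul, reTr_smul]
  have h₃ := congrArg (fun M => reTr (M * (A.1 * ξ.1))) h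
  simp only [Matrix.add_mul, reTr_add, Matrix.neg_mul, reTr_neg, h₁, h₂] at h₃
  rw [tracelessHermitian_inner, secondForm_apply, Matrix.add_mul, reTr_add]
  linarith

/-- The critical set is austere, whatever local parametrization is used. -/
lemma principalCurvatures_criticalZeroSet {k : ℕ}
    (hk : k = Module.finrank ℝ (Matrix (Fin 2) (Fin 2) F))
    {U : Set (EuclideanSpace ℝ (Fin k))} {φ : EuclideanSpace ℝ (Fin k) → tracelessHermitian 4 F}
    (hφ : IsLocalParametrization (criticalZeroSet 4 F) U φ) {x : EuclideanSpace ℝ (Fin k)}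
    (hx : x ∈ U) {ξ : tracelessHermitian 4 F} (hξ : ξ ∈ sphereNormalSpace φ x) :
    (principalCurvatures φ x ξ).map (fun c => -c) = principalCurvatures φ x ξ := by
  have hmem : ∀ y ∈ U, φ y ∈ criticalZeroSet 4 F := by
    intro y hy
    obtain ⟨W, -, hW⟩ := hφ.image_eq
    exact (hW ▸ Set.mem_image_of_mem φ hy : φ y ∈ criticalZeroSet 4 F ∩ W).1
  have hc : ∀ y ∈ U, (φ y).1 * (φ y).1 = (1 / 4 : ℝ) • 1 := fun y hy =>
    (mem_criticalZeroSet_iff _).1 (hmem y hy)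
  have hd : DifferentiableOn ℝ φ U := hφ.contDiffOn.differentiableOn (by simp)
  obtain ⟨B, C, hs⟩ := exists_isSplitting_of_mem (hmem x hx)
  have hinj := hφ.immersive x hx
  -- One inclusion is the differentiated equation; equality holds because the immersion has rank
  -- `k`, which bounds the dimension of the anticommutant.
  have hT : tangentSpaceOf φ x = anticommutant (φ x).1 := by
    refine Submodule.eq_of_le_of_finrank_le ?_ ?_
    · rintro _ ⟨v, rfl⟩
      exact fderiv_mem_anticommutant hφ.isOpen hd hc hx v
    · rw [tangentSpaceOf, LinearMap.finrank_range_of_inj hinj, finrank_euclideanSpace,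
        Fintype.card_fin, hk]
      exact finrank_anticommutant_le hs
  rw [sphereNormalSpace, Submodule.mem_orthogonal, hT] at hξ
  have hcomm := commute_of_orthogonal_anticommutant (hc x hx) fun X hX =>
    hξ X (Submodule.mem_sup_left hX)
  have hAξ : reTr ((φ x).1 * ξ.1) = 0 := by
    rw [← tracelessHermitian_inner]
    exact hξ _ (Submodule.mem_sup_right (Submodule.mem_span_singleton_self _))
  obtain ⟨Q, -, hQ, hQA, hQξ⟩ := hs.exists_unitary (tracelessHermitian_isHermitian ξ) hcomm
    (tracelessHermitian_reTr ξ) hAξ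
  have hQA' : (φ x).1 * Qᴴ = Qᴴ * (φ x).1 := by
    have := congrArg Matrix.conjTranspose hQA
    rwa [Matrix.conjTranspose_mul, Matrix.conjTranspose_mul, hs.isHermitian.eq] at this
  refine principalCurvatures_map_neg hinj (unitaryConj Q hQ) ?_ (inner_unitaryConj hQ)
    (secondForm (φ x).1 ξ.1) (fun u v => inner_second_fderiv (hc x hx) hcomm
      (second_fderiv_relation hφ.isOpen hφ.contDiffOn hc hx u v))
    (secondForm_unitaryConj hQ hQA hQξ)
  rw [hT]
  intro X hX
  rw [mem_anticommutant] at hX ⊢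
  show (φ x).1 * (Q * X.1 * Qᴴ) + Q * X.1 * Qᴴ * (φ x).1 = 0
  rw [Matrix.mul_assoc (Q * X.1), ← hQA', ← Matrix.mul_assoc, ← Matrix.mul_assoc, ← hQA,
    ← Matrix.mul_assoc (Q * X.1), ← Matrix.add_mul, Matrix.mul_assoc, Matrix.mul_assoc,
    ← Matrix.mul_add, hX]
  simp

end Tangent

/-! ### Frames and the projections onto their spans -/

section Frames

variable {F : Type*} [NormedDivisionRing F] [InnerProductSpace ℝ F] [StarRing F] [StarModule ℝ F]
  [IsScalarTower ℝ F F] [SMulCommClass ℝ F F] [IsEuclideanStar F]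

/-- The orthogonal projection onto the row space of `B`. -/
noncomputable def frameProj (B : Matrix (Fin 2) (Fin 4) F) : Matrix (Fin 4) (Fin 4) F :=
  Bᴴ * inv₂ (B * Bᴴ) * B

variable {B : Matrix (Fin 2) (Fin 4) F}

lemma vecMul_eq_sum_row (c : Fin 2 → F) (B : Matrix (Fin 2) (Fin 4) F) :
    c ᵥ* B = ∑ i, c i • B.row i :=
  Matrix.vecMul_eq_sum c B

lemma linearIndependent_of_mul_eq_one {N : Matrix (Fin 4) (Fin 2) F} (h : B * N = 1) :
    LinearIndependent F B.row := by
  rw [Fintype.linearIndependent_iff]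
  intro c hc i
  rw [← vecMul_eq_sum_row] at hc
  have : c ᵥ* (B * N) = 0 := by rw [← Matrix.vecMul_vecMul, hc, Matrix.zero_vecMul]
  rw [h, Matrix.vecMul_one] at this
  rw [this, Pi.zero_apply]

/-- If the Gram determinant vanishes, the adjugate `T` satisfies `(T * B) * (T * B)ᴴ = 0`, so the
rows of `T` are relations between the rows of `B`. Independence gives `T = 0`, and its trace then
forces `B = 0`. -/
lemma linearIndependent_iff_det₂_ne_zero :
    LinearIndependent F B.row ↔ det₂ (B * Bᴴ) ≠ 0 := by
  have hM := Matrix.isHermitian_mul_conjTranspose_self B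
  refine ⟨fun h hd => ?_, fun h => linearIndependent_of_mul_eq_one
    (N := Bᴴ * inv₂ (B * Bᴴ)) (by rw [← Matrix.mul_assoc, mul_inv₂ hM h])⟩
  have h₁ := mul_adjugate_two hM
  rw [hd, zero_smul] at h₁
  set T : Matrix (Fin 2) (Fin 2) F := reTr (B * Bᴴ) • 1 - B * Bᴴ with hT
  have hTH : Tᴴ = T := by
    rw [hT, Matrix.conjTranspose_sub, Matrix.conjTranspose_smul, Matrix.conjTranspose_one, hM.eq,
      star_trivial]
  have h₂ : T * B = 0 := by
    refine eq_zero_of_mul_conjTranspose _ ?_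
    rw [Matrix.conjTranspose_mul, hTH, Matrix.mul_assoc, ← Matrix.mul_assoc B, h₁,
      Matrix.mul_zero]
  have h₃ : T = 0 := by
    ext i j
    refine Fintype.linearIndependent_iff.1 h (T i) ?_ j
    exact (vecMul_eq_sum_row (T i) B).symm.trans (congrFun h₂ i)
  have h₄ := congrArg reTr h₃
  rw [hT, reTr_sub, reTr_smul, reTr_one, reTr_zero] at h₄
  have h₅ : reTr (B * Bᴴ) = 0 := by norm_num at h₄; linarith
  exact h.ne_zero 0 (congrFun (eq_zero_of_reTr_mul_conjTranspose B h₅) 0)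

section

variable (h : det₂ (B * Bᴴ) ≠ 0)
include h

lemma mul_frameProj : B * frameProj B = B := by
  rw [frameProj, Matrix.mul_assoc, ← Matrix.mul_assoc, ← Matrix.mul_assoc,
    mul_inv₂ (Matrix.isHermitian_mul_conjTranspose_self B) h, Matrix.one_mul]

lemma frameProj_mul_self : frameProj B * frameProj B = frameProj B := by
  nth_rw 1 [frameProj]
  rw [Matrix.mul_assoc, mul_frameProj h, frameProj]

lemma reTr_frameProj : reTr (frameProj B) = 2 := by
  rw [frameProj, Matrix.mul_assoc, reTr_mul_comm, Matrix.mul_assoc,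
    inv₂_mul (Matrix.isHermitian_mul_conjTranspose_self B) h, reTr_one]
  simp

end

lemma isHermitian_frameProj (B : Matrix (Fin 2) (Fin 4) F) : (frameProj B).IsHermitian :=
  Matrix.isHermitian_conjTranspose_mul_mul B
    (isHermitian_inv₂ (Matrix.isHermitian_mul_conjTranspose_self B))

/-- From `B * Q = B` and adjoints, `frameProj B` absorbs `Q` on both sides. The difference is then a
Hermitian projection of trace zero. -/
lemma frameProj_eq (h : det₂ (B * Bᴴ) ≠ 0) {Q : Matrix (Fin 4) (Fin 4) F} (hQ : Q * Q = Q)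
    (hH : Q.IsHermitian) (ht : reTr Q = 2) (hB : B * Q = B) : frameProj B = Q := by
  have hP := isHermitian_frameProj B
  have h₁ : frameProj B * Q = frameProj B := by rw [frameProj, Matrix.mul_assoc, hB]
  have h₂ : Q * frameProj B = frameProj B := by
    have := congrArg Matrix.conjTranspose h₁
    rwa [Matrix.conjTranspose_mul, hP.eq, hH.eq] at this
  refine (eq_of_reTr_eq_of_sub_mul_self (hH.sub hP) ?_ (by rw [ht, reTr_frameProj h])).symm
  rw [sub_mul, mul_sub, mul_sub, hQ, h₁, h₂, frameProj_mul_self h]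
  abel

/-- The shifted projection onto the row space, as a point of `E(4, F)`. -/
lemma frameProj_sub_mem (h : det₂ (B * Bᴴ) ≠ 0) :
    frameProj B - (1 / 2 : ℝ) • 1 ∈ tracelessHermitian 4 F := by
  refine tracelessHermitian_mem_iff.2 ⟨(isHermitian_frameProj B).sub ?_, ?_⟩
  · rw [Matrix.IsHermitian, Matrix.conjTranspose_smul, Matrix.conjTranspose_one, star_trivial]
  · rw [reTr_sub, reTr_frameProj h, reTr_smul, reTr_one]
    norm_num

variable [FiniteDimensional ℝ F]

lemma frameProj_sub_mem_criticalZeroSet (h : det₂ (B * Bᴴ) ≠ 0) :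
    (⟨_, frameProj_sub_mem h⟩ : tracelessHermitian 4 F) ∈ criticalZeroSet 4 F := by
  rw [mem_criticalZeroSet_iff]
  simp only [sub_mul, mul_sub, frameProj_mul_self h, Matrix.mul_smul, Matrix.smul_mul,
    Matrix.mul_one, Matrix.one_mul]
  module

section CriticalPoint

variable {A : tracelessHermitian 4 F} (hA : A ∈ criticalZeroSet 4 F)
include hA

lemma shift_mul_self : (A.1 + (1 / 2 : ℝ) • 1) * (A.1 + (1 / 2 : ℝ) • 1) =
    A.1 + (1 / 2 : ℝ) • 1 :=
  add_half_mul_self ((mem_criticalZeroSet_iff A).1 hA)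

omit hA in
lemma isHermitian_shift : (A.1 + (1 / 2 : ℝ) • 1).IsHermitian := by
  refine (tracelessHermitian_isHermitian A).add ?_
  rw [Matrix.IsHermitian, Matrix.conjTranspose_smul, Matrix.conjTranspose_one, star_trivial]

omit hA in
lemma reTr_shift : reTr (A.1 + (1 / 2 : ℝ) • 1) = 2 := by
  rw [reTr_add, tracelessHermitian_reTr, reTr_smul, reTr_one]
  norm_num

lemma frameProj_eq_shift (h : det₂ (B * Bᴴ) ≠ 0) (hB : B * (A.1 + (1 / 2 : ℝ) • 1) = B) :
    frameProj B = A.1 + (1 / 2 : ℝ) • 1 :=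
  frameProj_eq h (shift_mul_self hA) isHermitian_shift reTr_shift hB

end CriticalPoint

/-! ### Smoothness -/

variable {X : Type*} [NormedAddCommGroup X] [NormedSpace ℝ X] {x : X}

/-- The conjugate transpose as a continuous real-linear map. -/
noncomputable def conjTransposeCLM (m n : Type*) [Fintype m] [Fintype n] :
    Matrix m n F →L[ℝ] Matrix n m F :=
  LinearMap.toContinuousLinearMap
    { toFun := Matrix.conjTranspose
      map_add' := Matrix.conjTranspose_add
      map_smul' := fun c M => by rw [Matrix.conjTranspose_smul, star_trivial]; rfl }

lemma ContDiffAt.matrix_conjTranspose {m n : Type*} [Fintype m] [Fintype n]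
    {f : X → Matrix m n F} (hf : ContDiffAt ℝ ∞ f x) :
    ContDiffAt ℝ ∞ (fun y => (f y)ᴴ) x :=
  (conjTransposeCLM (F := F) m n).contDiff.contDiffAt.comp x hf

lemma ContDiffAt.matrix_reTr {n : Type*} [Fintype n] {f : X → Matrix n n F}
    (hf : ContDiffAt ℝ ∞ f x) : ContDiffAt ℝ ∞ (fun y => reTr (f y)) x :=
  (reTrCLM (F := F) n).contDiff.contDiffAt.comp x hf

lemma ContDiffAt.matrix_det₂ {f : X → Matrix (Fin 2) (Fin 2) F} (hf : ContDiffAt ℝ ∞ f x) :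
    ContDiffAt ℝ ∞ (fun y => det₂ (f y)) x :=
  ((hf.matrix_reTr.pow 2).sub (hf.matrix_mul hf).matrix_reTr).div_const 2

lemma ContDiffAt.matrix_inv₂ {f : X → Matrix (Fin 2) (Fin 2) F} (hf : ContDiffAt ℝ ∞ f x)
    (h : det₂ (f x) ≠ 0) : ContDiffAt ℝ ∞ (fun y => inv₂ (f y)) x :=
  (hf.matrix_det₂.inv h).smul ((hf.matrix_reTr.smul contDiffAt_const).sub hf)

lemma ContDiffAt.frameProj {f : X → Matrix (Fin 2) (Fin 4) F} (hf : ContDiffAt ℝ ∞ f x)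
    (h : det₂ (f x * (f x)ᴴ) ≠ 0) : ContDiffAt ℝ ∞ (fun y => frameProj (f y)) x :=
  (hf.matrix_conjTranspose.matrix_mul
    ((hf.matrix_mul hf.matrix_conjTranspose).matrix_inv₂ h)).matrix_mul hf

variable (F) in
-- Allows a map into `E(4, F)` to be defined, and proved smooth, from a formula that lies there only
-- for nondegenerate frames.
lemma exists_tracelessHermitian_retraction :
    ∃ r : Matrix (Fin 4) (Fin 4) F →L[ℝ] tracelessHermitian 4 F,
      ∀ A : tracelessHermitian 4 F, r A.1 = A := by
  obtain ⟨g, hg⟩ := LinearMap.exists_leftInverse_of_injective (tracelessHermitian 4 F).subtype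
    (Submodule.ker_subtype _)
  exact ⟨LinearMap.toContinuousLinearMap g, fun A => LinearMap.congr_fun hg A⟩

/-- The map from frames to the critical set. -/
noncomputable def frameMap (B : Matrix (Fin 2) (Fin 4) F) : tracelessHermitian 4 F :=
  (exists_tracelessHermitian_retraction F).choose (frameProj B - (1 / 2 : ℝ) • 1)

lemma frameMap_coe (h : det₂ (B * Bᴴ) ≠ 0) :
    (frameMap B).1 = frameProj B - (1 / 2 : ℝ) • 1 :=
  congrArg Subtype.val
    ((exists_tracelessHermitian_retraction F).choose_spec ⟨_, frameProj_sub_mem h⟩)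

lemma frameMap_mem (h : det₂ (B * Bᴴ) ≠ 0) : frameMap B ∈ criticalZeroSet 4 F := by
  have : frameMap B = ⟨_, frameProj_sub_mem h⟩ := Subtype.ext (frameMap_coe h)
  rw [this]
  exact frameProj_sub_mem_criticalZeroSet h

lemma frameMap_eq {A : tracelessHermitian 4 F} (hA : A ∈ criticalZeroSet 4 F)
    (h : det₂ (B * Bᴴ) ≠ 0) (hB : B * (A.1 + (1 / 2 : ℝ) • 1) = B) : frameMap B = A := by
  refine Subtype.ext ?_
  rw [frameMap_coe h, frameProj_eq_shift hA h hB, add_sub_cancel_right]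

lemma ContDiffAt.frameMap {f : X → Matrix (Fin 2) (Fin 4) F} (hf : ContDiffAt ℝ ∞ f x)
    (h : det₂ (f x * (f x)ᴴ) ≠ 0) : ContDiffAt ℝ ∞ (fun y => frameMap (f y)) x :=
  (exists_tracelessHermitian_retraction F).choose.contDiff.contDiffAt.comp x
    ((hf.frameProj h).sub contDiffAt_const)

/-! ### Local parametrizations of the critical set -/

/-- Continuity of `g` is needed only at image points; `chartInv` is known to be continuous only
where its block is invertible. -/
lemma isEmbedding_of_continuousAt_leftInverse {Y Z : Type*} [TopologicalSpace Y]
    [TopologicalSpace Z] {f : Y → Z} {g : Z → Y} (hf : Continuous f)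
    (hg : ∀ y, ContinuousAt g (f y)) (h : Function.LeftInverse g f) : Topology.IsEmbedding f := by
  refine ⟨Topology.isInducing_iff_nhds.2 fun y => le_antisymm (hf.tendsto y).le_comap ?_,
    h.injective⟩
  have h₁ : Filter.Tendsto g (𝓝 (f y)) (𝓝 y) := by
    have := hg y
    rwa [ContinuousAt, h y] at this
  calc Filter.comap f (𝓝 (f y)) ≤ Filter.comap f (Filter.comap g (𝓝 y)) :=
        Filter.comap_mono h₁.le_comap
    _ = 𝓝 y := by rw [Filter.comap_comap, h.comp_eq_id, Filter.comap_id]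

section Chart

variable {A : Matrix (Fin 4) (Fin 4) F} {C : Matrix (Fin 2) (Fin 4) F}

/-- `Bᴴ` is a right inverse of `B + Y * C`, so the graph chart is defined for every `Y`. -/
lemma IsSplitting.det₂_ne_zero (h : IsSplitting A B C) (Y : Matrix (Fin 2) (Fin 2) F) :
    det₂ ((B + Y * C) * (B + Y * C)ᴴ) ≠ 0 := by
  refine linearIndependent_iff_det₂_ne_zero.1 (linearIndependent_of_mul_eq_one (N := Bᴴ) ?_)
  rw [Matrix.add_mul, h.left, Matrix.mul_assoc, h.right_left, Matrix.mul_zero, add_zero]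

/-- The inverse of the chart `Y ↦ frameMap (B + Y * C)`. -/
noncomputable def chartInv (B C : Matrix (Fin 2) (Fin 4) F) (q : tracelessHermitian 4 F) :
    Matrix (Fin 2) (Fin 2) F :=
  inv₂ (B * (q.1 + (1 / 2 : ℝ) • 1) * Bᴴ) * (B * (q.1 + (1 / 2 : ℝ) • 1) * Cᴴ)

lemma IsSplitting.left_frameProj (h : IsSplitting A B C) (Y : Matrix (Fin 2) (Fin 2) F) :
    B * frameProj (B + Y * C) = inv₂ ((B + Y * C) * (B + Y * C)ᴴ) * (B + Y * C) := by
  have : B * (B + Y * C)ᴴ = 1 := by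
    rw [Matrix.conjTranspose_add, Matrix.conjTranspose_mul, Matrix.mul_add, h.left,
      ← Matrix.mul_assoc, h.left_right, Matrix.zero_mul, add_zero]
  rw [frameProj, ← Matrix.mul_assoc, ← Matrix.mul_assoc, this, Matrix.one_mul]

/-- With `G` the Gram matrix of `B + Y * C`, the upper blocks of the projection are `G⁻¹` and, by
`chart_right`, `G⁻¹ * Y`. Their quotient recovers `Y`, which explains `chartInv`. -/
lemma IsSplitting.chart_left (h : IsSplitting A B C) (Y : Matrix (Fin 2) (Fin 2) F) :
    B * ((frameMap (B + Y * C)).1 + (1 / 2 : ℝ) • 1) * Bᴴ =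
      inv₂ ((B + Y * C) * (B + Y * C)ᴴ) := by
  rw [frameMap_coe (h.det₂_ne_zero Y), sub_add_cancel, h.left_frameProj, Matrix.mul_assoc,
    Matrix.add_mul B _ Bᴴ, h.left, Matrix.mul_assoc, h.right_left, Matrix.mul_zero, add_zero,
    Matrix.mul_one]

lemma IsSplitting.chart_right (h : IsSplitting A B C) (Y : Matrix (Fin 2) (Fin 2) F) :
    B * ((frameMap (B + Y * C)).1 + (1 / 2 : ℝ) • 1) * Cᴴ =
      inv₂ ((B + Y * C) * (B + Y * C)ᴴ) * Y := by
  rw [frameMap_coe (h.det₂_ne_zero Y), sub_add_cancel, h.left_frameProj, Matrix.mul_assoc,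
    Matrix.add_mul B _ Cᴴ, h.left_right, Matrix.mul_assoc, h.right, Matrix.mul_one, zero_add]

lemma IsSplitting.det₂_chart_ne_zero (h : IsSplitting A B C) (Y : Matrix (Fin 2) (Fin 2) F) :
    det₂ (B * ((frameMap (B + Y * C)).1 + (1 / 2 : ℝ) • 1) * Bᴴ) ≠ 0 := by
  have hH := Matrix.isHermitian_mul_conjTranspose_self (B + Y * C)
  rw [h.chart_left]
  exact det₂_ne_zero_of_mul_eq_one (isHermitian_inv₂ hH) (mul_inv₂ hH (h.det₂_ne_zero Y))

lemma IsSplitting.chartInv_frameMap (h : IsSplitting A B C) (Y : Matrix (Fin 2) (Fin 2) F) :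
    chartInv B C (frameMap (B + Y * C)) = Y := by
  have hd := h.det₂_chart_ne_zero Y
  have hH := isHermitian_inv₂ (Matrix.isHermitian_mul_conjTranspose_self (B + Y * C))
  rw [chartInv, h.chart_right, ← Matrix.mul_assoc]
  rw [h.chart_left] at hd ⊢
  rw [inv₂_mul hH hd, Matrix.one_mul]

lemma IsSplitting.frameMap_chartInv (h : IsSplitting A B C) {q : tracelessHermitian 4 F}
    (hq : q ∈ criticalZeroSet 4 F) (hd : det₂ (B * (q.1 + (1 / 2 : ℝ) • 1) * Bᴴ) ≠ 0) :
    frameMap (B + chartInv B C q * C) = q := by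
  refine frameMap_eq hq (h.det₂_ne_zero _) ?_
  set P := q.1 + (1 / 2 : ℝ) • (1 : Matrix (Fin 4) (Fin 4) F) with hP
  have h₁ : B * P = B * P * Bᴴ * B + B * P * Cᴴ * C := by
    conv_lhs => rw [← Matrix.mul_one (B * P), ← h.sum]
    simp only [Matrix.mul_add, Matrix.mul_assoc]
  -- The graph frame is an invertible multiple of `B * P`, so `P` fixes its rows.
  have h₂ : B + chartInv B C q * C = inv₂ (B * P * Bᴴ) * (B * P) := by
    conv_rhs => rw [congrArg (inv₂ (B * P * Bᴴ) * ·) h₁]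
    rw [Matrix.mul_add, ← Matrix.mul_assoc _ _ B, ← Matrix.mul_assoc _ _ C,
      inv₂_mul (Matrix.isHermitian_mul_mul_conjTranspose B isHermitian_shift) hd, Matrix.one_mul]
    rfl
  rw [h₂, Matrix.mul_assoc _ (B * P), Matrix.mul_assoc B P P,
    show P * P = P from shift_mul_self hq]

lemma contDiff_shift :
    ContDiff ℝ ∞ (fun q : tracelessHermitian 4 F => q.1 + (1 / 2 : ℝ) • 1) :=
  (tracelessHermitian 4 F).subtypeL.contDiff.add contDiff_const

lemma contDiffAt_chartInv {q : tracelessHermitian 4 F}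
    (hd : det₂ (B * (q.1 + (1 / 2 : ℝ) • 1) * Bᴴ) ≠ 0) :
    ContDiffAt ℝ ∞ (chartInv B C) q := by
  have h := (contDiffAt_const (c := B)).matrix_mul (contDiff_shift (F := F)).contDiffAt (x := q)
  exact ((h.matrix_mul contDiffAt_const).matrix_inv₂ hd).matrix_mul (h.matrix_mul contDiffAt_const)

lemma IsSplitting.isLocalParametrization (h : IsSplitting A B C) {k : ℕ}
    (L : EuclideanSpace ℝ (Fin k) ≃L[ℝ] Matrix (Fin 2) (Fin 2) F) :
    IsLocalParametrization (criticalZeroSet 4 F) Set.univ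
      (fun y => frameMap (B + L y * C)) := by
  have hφ : ContDiff ℝ ∞ (fun y => frameMap (B + L y * C)) := by
    refine contDiff_iff_contDiffAt.2 fun y => ContDiffAt.frameMap ?_ (h.det₂_ne_zero _)
    exact contDiffAt_const.add (L.contDiff.contDiffAt.matrix_mul contDiffAt_const)
  have hψ : ∀ y, ContDiffAt ℝ ∞ (fun q => L.symm (chartInv B C q)) (frameMap (B + L y * C)) :=
    fun y => L.symm.contDiff.contDiffAt.comp _ (contDiffAt_chartInv (h.det₂_chart_ne_zero _))
  have hinv : Function.LeftInverse (fun q => L.symm (chartInv B C q))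
      (fun y => frameMap (B + L y * C)) := fun y => by
    simp only [h.chartInv_frameMap, L.symm_apply_apply]
  refine ⟨isOpen_univ, hφ.contDiffOn, fun y _ => ?_, ?_, ?_⟩
  -- The chain rule for the smooth left inverse gives a left inverse of the derivative, hence
  -- immersivity.
  · have h₁ := ((hψ y).differentiableAt (by simp)).hasFDerivAt.comp y
      (hφ.differentiable (by simp) y).hasFDerivAt
    have h₂ : (fun q => L.symm (chartInv B C q)) ∘ (fun y => frameMap (B + L y * C)) = id :=
      hinv.comp_eq_id
    rw [h₂] at h₁
    have h₃ := h₁.unique (hasFDerivAt_id y)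
    refine Function.LeftInverse.injective (g := fderiv ℝ (fun q => L.symm (chartInv B C q))
      (frameMap (B + L y * C))) fun v => ?_
    exact congrArg (fun T : EuclideanSpace ℝ (Fin k) →L[ℝ] EuclideanSpace ℝ (Fin k) => T v) h₃
  · exact (isEmbedding_of_continuousAt_leftInverse hφ.continuous
      (fun y => (hψ y).continuousAt) hinv).comp Topology.IsEmbedding.subtypeVal
  · refine ⟨{q | det₂ (B * (q.1 + (1 / 2 : ℝ) • 1) * Bᴴ) ≠ 0}, ?_, ?_⟩
    · have hc : Continuous fun q : tracelessHermitian 4 F =>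
          det₂ (B * (q.1 + (1 / 2 : ℝ) • 1) * Bᴴ) :=
        (contDiff_iff_contDiffAt.2 fun q => (((contDiffAt_const (c := B)).matrix_mul
          (contDiff_shift (F := F)).contDiffAt).matrix_mul contDiffAt_const).matrix_det₂).continuous
      exact isOpen_ne_fun hc continuous_const
    · ext q
      constructor
      · rintro ⟨y, -, rfl⟩
        exact ⟨frameMap_mem (h.det₂_ne_zero _), h.det₂_chart_ne_zero _⟩
      · rintro ⟨hq, hd⟩
        refine ⟨L.symm (chartInv B C q), trivial, ?_⟩
        simp only [L.apply_symm_apply]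
        exact h.frameMap_chartInv hq hd

end Chart

variable (F) in
lemma isEmbeddedSubmanifold_criticalZeroSet :
    IsEmbeddedSubmanifold (Module.finrank ℝ (Matrix (Fin 2) (Fin 2) F)) (criticalZeroSet 4 F) := by
  intro p hp
  obtain ⟨B, C, hs⟩ := exists_isSplitting_of_mem hp
  let L : EuclideanSpace ℝ (Fin (Module.finrank ℝ (Matrix (Fin 2) (Fin 2) F))) ≃L[ℝ]
    Matrix (Fin 2) (Fin 2) F := ContinuousLinearEquiv.ofFinrankEq (by simp)
  refine ⟨Set.univ, _, hs.isLocalParametrization L, 0, trivial, ?_⟩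
  have hd := hs.det₂_ne_zero 0
  simp only [map_zero, Matrix.zero_mul, add_zero] at hd ⊢
  refine frameMap_eq hp hd ?_
  rw [← hs.left_sum, ← Matrix.mul_assoc, hs.left, Matrix.one_mul]

variable (F) in
lemma isAustere_criticalZeroSet : IsAustereSubmanifoldOfSphere (criticalZeroSet 4 F) :=
  ⟨criticalZeroSet_subset_sphere, _, isEmbeddedSubmanifold_criticalZeroSet F,
    fun _ _ hφ _ hx _ hξ => principalCurvatures_criticalZeroSet rfl hφ hx hξ⟩

end Frames

/-! ### The critical set and the Grassmannian -/

section Grassmannian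

variable {F : Type*} [NormedDivisionRing F] [InnerProductSpace ℝ F] [StarRing F] [StarModule ℝ F]
  [IsScalarTower ℝ F F] [SMulCommClass ℝ F F] [IsEuclideanStar F]

/-- The row vectors fixed by `P`. -/
def fixedSpace (P : Matrix (Fin 4) (Fin 4) F) : Submodule F (Fin 4 → F) where
  carrier := {v | v ᵥ* P = v}
  add_mem' := by
    intro v w (hv : v ᵥ* P = v) (hw : w ᵥ* P = w)
    show (v + w) ᵥ* P = v + w
    rw [Matrix.add_vecMul, hv, hw]
  zero_mem' := Matrix.zero_vecMul P
  smul_mem' := by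
    intro c v (hv : v ᵥ* P = v)
    show (c • v) ᵥ* P = c • v
    rw [Matrix.smul_vecMul, hv]

lemma mul_eq_of_rows_mem {P : Matrix (Fin 4) (Fin 4) F} {B : Matrix (Fin 2) (Fin 4) F}
    (h : ∀ i, B.row i ∈ fixedSpace P) : B * P = B :=
  funext fun i => h i

variable {B : Matrix (Fin 2) (Fin 4) F}

/-- A vector fixed by the projection is `(v ᵥ* (Bᴴ * inv₂ (B * Bᴴ))) ᵥ* B`, a left combination of
the rows. -/
lemma span_rows_eq_fixedSpace (h : det₂ (B * Bᴴ) ≠ 0) :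
    Submodule.span F (Set.range B.row) = fixedSpace (frameProj B) := by
  refine le_antisymm (Submodule.span_le.2 ?_) fun v hv => ?_
  · rintro _ ⟨i, rfl⟩
    exact congrFun (mul_frameProj h) i
  · rw [Submodule.mem_span_range_iff_exists_fun]
    refine ⟨v ᵥ* (Bᴴ * inv₂ (B * Bᴴ)), ?_⟩
    rw [← vecMul_eq_sum_row, Matrix.vecMul_vecMul]
    exact hv

lemma det₂_ne_zero_of_mem_frames (b : frames 2 4 F) :
    det₂ (Matrix.of b.1 * (Matrix.of b.1)ᴴ) ≠ 0 :=
  linearIndependent_iff_det₂_ne_zero.1 b.2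

variable [FiniteDimensional ℝ F]

lemma exists_frame_of_mem {A : tracelessHermitian 4 F} (hA : A ∈ criticalZeroSet 4 F) :
    ∃ B : Matrix (Fin 2) (Fin 4) F, B * Bᴴ = 1 ∧ frameProj B = A.1 + (1 / 2 : ℝ) • 1 ∧
      det₂ (B * Bᴴ) ≠ 0 := by
  obtain ⟨B, C, hs⟩ := exists_isSplitting_of_mem hA
  have hd : det₂ (B * Bᴴ) ≠ 0 :=
    linearIndependent_iff_det₂_ne_zero.1 (linearIndependent_of_mul_eq_one hs.left)
  refine ⟨B, hs.left, frameProj_eq_shift hA hd ?_, hd⟩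
  rw [← hs.left_sum, ← Matrix.mul_assoc, hs.left, Matrix.one_mul]

/-- The eigenspace of a critical point for the eigenvalue `½`. -/
noncomputable def eigenplane (A : criticalZeroSet 4 F) : Gr 2 4 F :=
  ⟨fixedSpace (A.1.1 + (1 / 2 : ℝ) • 1), by
    obtain ⟨B, -, hB, hd⟩ := exists_frame_of_mem A.2
    rw [← hB, ← span_rows_eq_fixedSpace hd,
      finrank_span_eq_card (linearIndependent_iff_det₂_ne_zero.2 hd), Fintype.card_fin]⟩

lemma eigenplane_frameMap (b : frames 2 4 F) :
    eigenplane ⟨frameMap (Matrix.of b.1), frameMap_mem (det₂_ne_zero_of_mem_frames b)⟩ =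
      frameSpan b := by
  refine Subtype.ext ?_
  have h := det₂_ne_zero_of_mem_frames b
  show fixedSpace ((frameMap (Matrix.of b.1)).1 + (1 / 2 : ℝ) • 1) =
    Submodule.span F (Set.range b.1)
  rw [frameMap_coe h, sub_add_cancel, ← span_rows_eq_fixedSpace h]
  rfl

/-- A frame of the common plane determines both shifted matrices as its `frameProj`. -/
lemma eigenplane_injective : Function.Injective (eigenplane (F := F)) := by
  intro A A' h
  obtain ⟨B, -, hB, hd⟩ := exists_frame_of_mem A.2
  have hfix : fixedSpace (A.1.1 + (1 / 2 : ℝ) • 1) = fixedSpace (A'.1.1 + (1 / 2 : ℝ) • 1) :=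
    congrArg Subtype.val h
  have hrow : B * (A'.1.1 + (1 / 2 : ℝ) • 1) = B := mul_eq_of_rows_mem fun i => by
    rw [← hfix, ← hB, ← span_rows_eq_fixedSpace hd]
    exact Submodule.subset_span ⟨i, rfl⟩
  have h' := frameProj_eq_shift A'.2 hd hrow
  rw [hB] at h'
  exact Subtype.ext (Subtype.ext (add_right_cancel h'))

lemma frameSpan_surjective : Function.Surjective (frameSpan (k := 2) (n := 4) (F := F)) := by
  rintro ⟨V, hV⟩
  let b := Module.finBasisOfFinrankEq F V hV
  have hb : LinearIndependent F (fun i => (b i : Fin 4 → F)) :=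
    b.linearIndependent.map' V.subtype (Submodule.ker_subtype V)
  refine ⟨⟨fun i => b i, hb⟩, Subtype.ext ?_⟩
  show Submodule.span F (Set.range fun i => (b i : Fin 4 → F)) = V
  have h := congrArg (Submodule.map V.subtype) b.span_eq
  rw [Submodule.map_span, ← Set.range_comp, Submodule.map_subtype_top] at h
  exact h

lemma eigenplane_bijective : Function.Bijective (eigenplane (F := F)) := by
  refine ⟨eigenplane_injective, fun V => ?_⟩
  obtain ⟨b, rfl⟩ := frameSpan_surjective V
  exact ⟨_, eigenplane_frameMap b⟩

variable (F) in
/-- Tuples of row vectors, with the supremum norm, as matrices. -/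
noncomputable def ofCLE : (Fin 2 → Fin 4 → F) ≃L[ℝ] Matrix (Fin 2) (Fin 4) F :=
  (Matrix.ofLinearEquiv ℝ).toContinuousLinearEquiv

/-- The rows of `B`, projected to the eigenplane of `q`. -/
noncomputable def localFrame (B : Matrix (Fin 2) (Fin 4) F) (q : tracelessHermitian 4 F) :
    Fin 2 → Fin 4 → F :=
  (ofCLE F).symm (B * (q.1 + (1 / 2 : ℝ) • 1))

lemma contDiff_localFrame (B : Matrix (Fin 2) (Fin 4) F) : ContDiff ℝ ∞ (localFrame B) :=
  (ofCLE F).symm.contDiff.comp (contDiff_iff_contDiffAt.2 fun _ =>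
    (contDiffAt_const (c := B)).matrix_mul (contDiff_shift (F := F)).contDiffAt)

/-- The determinant of the Gram matrix of `localFrame B q`. -/
noncomputable def localGram (B : Matrix (Fin 2) (Fin 4) F) (q : tracelessHermitian 4 F) : ℝ :=
  det₂ ((B * (q.1 + (1 / 2 : ℝ) • 1)) * (B * (q.1 + (1 / 2 : ℝ) • 1))ᴴ)

lemma continuous_localGram (B : Matrix (Fin 2) (Fin 4) F) : Continuous (localGram B) := by
  have h : ∀ q, ContDiffAt ℝ ∞
      (fun q : tracelessHermitian 4 F => B * (q.1 + (1 / 2 : ℝ) • 1)) q := fun q =>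
    (contDiffAt_const (c := B)).matrix_mul (contDiff_shift (F := F)).contDiffAt
  exact (contDiff_iff_contDiffAt.2 fun q =>
    ((h q).matrix_mul (h q).matrix_conjTranspose).matrix_det₂).continuous

lemma localFrame_mem {q : tracelessHermitian 4 F} (h : localGram B q ≠ 0) :
    localFrame B q ∈ frames 2 4 F :=
  linearIndependent_iff_det₂_ne_zero.2 h

lemma frameSpan_localFrame {q : criticalZeroSet 4 F} (h : localGram B q.1 ≠ 0) :
    frameSpan ⟨localFrame B q.1, localFrame_mem h⟩ = eigenplane q := by
  rw [← eigenplane_frameMap]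
  congr 1
  refine Subtype.ext (frameMap_eq q.2 h ?_)
  show B * (q.1.1 + (1 / 2 : ℝ) • 1) * (q.1.1 + (1 / 2 : ℝ) • 1) = B * (q.1.1 + (1 / 2 : ℝ) • 1)
  rw [Matrix.mul_assoc, shift_mul_self q.2]

lemma exists_localGram_ne_zero (p : criticalZeroSet 4 F) :
    ∃ B : Matrix (Fin 2) (Fin 4) F, localGram B p.1 ≠ 0 := by
  obtain ⟨B, -, hB, hd⟩ := exists_frame_of_mem p.2
  refine ⟨B, ?_⟩
  rw [localGram, ← hB, mul_frameProj hd]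
  exact hd

/-- Near each point the plane lifts to the continuous frame `localFrame B`, and the quotient map
from frames is continuous. -/
lemma continuous_eigenplane : Continuous (eigenplane (F := F)) := by
  refine continuous_iff_continuousAt.2 fun p => ?_
  obtain ⟨B, hB⟩ := exists_localGram_ne_zero p
  have hopen : IsOpen {q : criticalZeroSet 4 F | localGram B q.1 ≠ 0} :=
    isOpen_ne_fun ((continuous_localGram B).comp continuous_subtype_val) continuous_const
  refine ContinuousOn.continuousAt (s := {q : criticalZeroSet 4 F | localGram B q.1 ≠ 0}) ?_
    (hopen.mem_nhds hB)
  rw [continuousOn_iff_continuous_domRestrict]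
  have h₁ : Continuous fun q : {q : criticalZeroSet 4 F | localGram B q.1 ≠ 0} =>
      (⟨localFrame B q.1.1, localFrame_mem q.2⟩ : frames 2 4 F) :=
    ((contDiff_localFrame B).continuous.comp
      (continuous_subtype_val.comp continuous_subtype_val)).subtype_mk _
  have h₂ : Continuous (frameSpan (k := 2) (n := 4) (F := F)) := continuous_coinduced_rng
  refine (h₂.comp h₁).congr fun q => ?_
  exact frameSpan_localFrame q.2

lemma contDiffAt_frameMap_of (b : frames 2 4 F) :
    ContDiffAt ℝ ∞ (fun b : Fin 2 → Fin 4 → F => frameMap (Matrix.of b)) b.1 :=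
  ContDiffAt.frameMap (f := fun b => ofCLE F b) (ofCLE F).contDiff.contDiffAt
    (det₂_ne_zero_of_mem_frames b)

variable (F) in
/-- The homeomorphism of the Grassmannian onto the critical set. -/
noncomputable def grassmannHomeo : Gr 2 4 F ≃ₜ criticalZeroSet 4 F :=
  { (Equiv.ofBijective eigenplane eigenplane_bijective).symm with
    continuous_toFun := by
      -- By the quotient topology it suffices to check continuity on frames, where the map is
      -- `frameMap`.
      refine continuous_coinduced_dom.2 ?_
      have h : Continuous fun b : frames 2 4 F =>
          (⟨frameMap (Matrix.of b.1), frameMap_mem (det₂_ne_zero_of_mem_frames b)⟩ :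
            criticalZeroSet 4 F) := by
        refine Continuous.subtype_mk (continuous_iff_continuousAt.2 fun b => ?_) _
        exact (contDiffAt_frameMap_of b).continuousAt.comp continuous_subtype_val.continuousAt
      refine h.congr fun b => ?_
      exact ((Equiv.ofBijective eigenplane eigenplane_bijective).symm_apply_eq.2
        (eigenplane_frameMap b).symm).symm
    continuous_invFun := continuous_eigenplane }

lemma grassmannHomeo_symm_apply (p : criticalZeroSet 4 F) :
    (grassmannHomeo F).symm p = eigenplane p := rfl

lemma grassmannHomeo_frameSpan (b : frames 2 4 F) : (grassmannHomeo F (frameSpan b)) =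
    ⟨frameMap (Matrix.of b.1), frameMap_mem (det₂_ne_zero_of_mem_frames b)⟩ := by
  rw [← Homeomorph.eq_symm_apply, grassmannHomeo_symm_apply, eigenplane_frameMap]

variable (F) in
lemma isGrassmannDiffeo_grassmannHomeo : IsGrassmannDiffeo (grassmannHomeo F) where
  smooth_toFun := by
    refine ⟨fun b => frameMap (Matrix.of b), fun b hb =>
      (contDiffAt_frameMap_of ⟨b, hb⟩).contDiffWithinAt, fun b => ?_⟩
    exact (congrArg Subtype.val (grassmannHomeo_frameSpan b)).symm
  smooth_invFun := by
    intro p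
    obtain ⟨B, hB⟩ := exists_localGram_ne_zero p
    refine ⟨localFrame B, (contDiff_localFrame B).contDiffAt, ?_⟩
    filter_upwards [(continuous_localGram B).continuousAt.eventually_ne hB] with q hq hqm
    exact ⟨localFrame_mem hq, frameSpan_localFrame (q := ⟨q, hqm⟩) hq⟩

end Grassmannian

end

theorem mainTheorem5 :
    (criticalZeroSet 4 ℝ
        = conjugationOrbit (Matrix.specialOrthogonalGroup (Fin 4) ℝ) (halfDiag ℝ) ∧
      IsCompact (criticalZeroSet 4 ℝ) ∧
      IsAustereSubmanifoldOfSphere (criticalZeroSet 4 ℝ) ∧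
      ∃ e : Gr 2 4 ℝ ≃ₜ criticalZeroSet 4 ℝ, IsGrassmannDiffeo e) ∧
    (criticalZeroSet 4 ℂ
        = conjugationOrbit (Matrix.unitaryGroup (Fin 4) ℂ) (halfDiag ℂ) ∧
      IsCompact (criticalZeroSet 4 ℂ) ∧
      IsAustereSubmanifoldOfSphere (criticalZeroSet 4 ℂ) ∧
      ∃ e : Gr 2 4 ℂ ≃ₜ criticalZeroSet 4 ℂ, IsGrassmannDiffeo e) ∧
    (criticalZeroSet 4 ℍ[ℝ]
        = conjugationOrbit (unitary (Matrix (Fin 4) (Fin 4) ℍ[ℝ])) (halfDiag ℍ[ℝ]) ∧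
      IsCompact (criticalZeroSet 4 ℍ[ℝ]) ∧
      IsAustereSubmanifoldOfSphere (criticalZeroSet 4 ℍ[ℝ]) ∧
      ∃ e : Gr 2 4 ℍ[ℝ] ≃ₜ criticalZeroSet 4 ℍ[ℝ], IsGrassmannDiffeo e) :=
  ⟨⟨criticalZeroSet_real_eq_orbit, isCompact_criticalZeroSet, isAustere_criticalZeroSet ℝ,
      grassmannHomeo ℝ, isGrassmannDiffeo_grassmannHomeo ℝ⟩,
    ⟨criticalZeroSet_eq_orbit, isCompact_criticalZeroSet, isAustere_criticalZeroSet ℂ,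
      grassmannHomeo ℂ, isGrassmannDiffeo_grassmannHomeo ℂ⟩,
    ⟨criticalZeroSet_eq_orbit, isCompact_criticalZeroSet, isAustere_criticalZeroSet ℍ[ℝ],
      grassmannHomeo ℍ[ℝ], isGrassmannDiffeo_grassmannHomeo ℍ[ℝ]⟩⟩
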